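/- Conventions. An operator system is a complex $*$-vector space $V$ with proper cones $M_n(V)^+\subseteq M_n(V)_h$ ($n\in\mathbb N$) satisfying $XM_n(V)^+X^*\subseteq M_m(V)^+$ for all $X\in M_{m,n}(\mathbb C)$, and with an Archimedean matrix order unit $e_V\in V_h$. For a unital $C^*$-algebra $\mathcal A$, an operator $\mathcal A$-system is an operator system $V$ that is a unital $\mathcal A$-bimodule (with $\mathbb C$-bilinear actions) such that $(a\cdot s)^*=s^*\cdot a^*$, $a\cdot e_V=e_V\cdot a$, and $B\cdot x\cdot B^*\in M_m(V)^+$ for all $B\in M_{m,n}(\mathcal A)$ and $x\in M_n(V)^+$. It is faithful if $a\cdot e_V\neq 0$ for every $a\in\mathcal A\setminus\{0\}$. The direct sum of operator $\mathcal A$-systems is the direct sum of vector spaces with coordinatewise involution, cones, unit and actions; u.c.p. means unital and completely positive. A subspace $\mathcal J$ of an operator system $V$ is a kernel in $V$ if it is the kernel of a u.c.p. map from $V$ to some operator system. In that case the quotient operator system is $V/\mathcal J$ with the induced involution, the unit $e_V+\mathcal J$ and the cones $$C_n=\{y\in M_n(V/\mathcal J): \varepsilon (e_V+\mathcal J)\otimes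 I_n+y\in D_n\ \text{for all } \varepsilon>0\},$$ where $D_n$ is the image of $M_n(V)^+$ in $M_n(V/\mathcal J)$. A coproduct of faithful operator $\mathcal A$-systems $\mathcal S,\mathcal T$ is a faithful operator $\mathcal A$-system $\mathcal P$ with unital complete order embeddings $\phi_1:\mathcal S\to \mathcal P$, $\phi_2:\mathcal T\to \mathcal P$ that are $\mathcal A$-bimodule maps, such that for every operator $\mathcal A$-system $\mathcal R$ and all u.c.p. $\mathcal A$-bimodule maps $\psi_1:\mathcal S\to \mathcal R$, $\psi_2:\mathcal T\to \mathcal R$ there is a unique u.c.p. $\mathcal A$-bimodule map $\Psi:\mathcal P\to \mathcal R$ with $\Psi\circ\phi_i=\psi_i$ for $i=1,2$. It is denoted $\mathcal S\oplus_{\mathcal A}\mathcal T$. Theorem. Let $\mathcal A$ be a unital $C^*$-algebra, let $\mathcal S$ and $\mathcal T$ be faithful operator $\mathcal A$-systems, and let $$\mathcal J=\{(a\cdot e_{\mathcal S})\oplus(-a\cdot e_{\mathcal T}): a\in\mathcal A\}\subseteq \mathcal S\oplus \mathcal T .$$ Then $\mathcal J$ is a kernel in $\mathcal S\oplus \mathcal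 T$, and there is an operator $\mathcal A$-system structure on $(\mathcal S\oplus \mathcal T)/\mathcal J$ whose underlying operator system is the quotient operator system and for which the quotient map $q:\mathcal S\oplus \mathcal T\to(\mathcal S\oplus \mathcal T)/\mathcal J$ is a u.c.p. $\mathcal A$-bimodule map. With this structure and the maps $s\mapsto 2q(s\oplus 0)$ and $t\mapsto 2q(0\oplus t)$, $(\mathcal S\oplus \mathcal T)/\mathcal J$ is a coproduct of $\mathcal S$ and $\mathcal T$. Consequently, for every coproduct $(\mathcal S\oplus_{\mathcal A}\mathcal T,\phi_1,\phi_2)$ there is a unital complete order isomorphism $\Theta:(\mathcal S\oplus \mathcal T)/\mathcal J\to \mathcal S\oplus_{\mathcal A}\mathcal T$ that is an $\mathcal A$-bimodule map and satisfies $\Theta(2q(s\oplus 0))=\phi_1(s)$ and $\Theta(2q(0\oplus t))=\phi_2(t)$ for all $s\in \mathcal S$ and $t\in \mathcal T$. -/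

import Mathlib

universe u v w p a

/-- A complex *-vector space structure on `V`: a conjugate-linear involution. -/
structure StarSpace (V : Type u) [AddCommGroup V] [Module ℂ V] where
  adj : V →ₗ⋆[ℂ] V
  adj_adj : ∀ v, adj (adj v) = v

section basics

variable {V : Type u} [AddCommGroup V] [Module ℂ V]
variable {W : Type v} [AddCommGroup W] [Module ℂ W]

/-- `x` is hermitian in `M_n(V)` for the involution `[v_{ij}]* = [v_{ji}*]`. -/
def StarSpace.IsHermitian (𝒱 : StarSpace V) {n : ℕ} (x : Matrix (Fin n) (Fin n) V) : Prop :=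
  ∀ i j, 𝒱.adj (x j i) = x i j

/-- The matrix `X x X*`, for a scalar matrix `X` and a matrix `x` over `V`. -/
def scalarConj {m n : ℕ} (X : Matrix (Fin m) (Fin n) ℂ) (x : Matrix (Fin n) (Fin n) V) :
    Matrix (Fin m) (Fin m) V :=
  Matrix.of fun i j => ∑ k, ∑ l, (X i k * star (X j l)) • x k l

/-- The diagonal matrix `e_n`, with all diagonal entries equal to `e`. -/
def ampl (n : ℕ) (e : V) : Matrix (Fin n) (Fin n) V :=
  Matrix.diagonal fun _ => e

end basics

/-- A matrix ordered *-vector space. -/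
structure MatrixOrderedSpace (V : Type u) [AddCommGroup V] [Module ℂ V] extends StarSpace V where
  /-- the cone of positive elements of `M_n(V)` -/
  cone : (n : ℕ) → Set (Matrix (Fin n) (Fin n) V)
  cone_nonempty : ∀ n, (cone n).Nonempty
  cone_hermitian : ∀ {n} {x : Matrix (Fin n) (Fin n) V}, x ∈ cone n → toStarSpace.IsHermitian x
  cone_add : ∀ {n} {x y : Matrix (Fin n) (Fin n) V}, x ∈ cone n → y ∈ cone n → x + y ∈ cone n
  cone_smul : ∀ {n} {r : ℝ} {x : Matrix (Fin n) (Fin n) V}, 0 ≤ r → x ∈ cone n →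
    (r : ℂ) • x ∈ cone n
  cone_proper : ∀ {n} {x : Matrix (Fin n) (Fin n) V}, x ∈ cone n → -x ∈ cone n → x = 0
  cone_conj : ∀ {m n} (X : Matrix (Fin m) (Fin n) ℂ) {x : Matrix (Fin n) (Fin n) V},
    x ∈ cone n → scalarConj X x ∈ cone m

/-- An (abstract) operator system structure on `V`: a matrix ordering together with an
Archimedean matrix order unit. -/
structure OperatorSystem (V : Type u) [AddCommGroup V] [Module ℂ V]
    extends MatrixOrderedSpace V where
  unit : V
  adj_unit : adj unit = unit
  order_unit : ∀ {n} {x : Matrix (Fin n) (Fin n) V}, toStarSpace.IsHermitian x →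
    ∃ r : ℝ, 0 < r ∧ (r : ℂ) • ampl n unit - x ∈ cone n
  archimedean : ∀ {n} {x : Matrix (Fin n) (Fin n) V}, toStarSpace.IsHermitian x →
    (∀ r : ℝ, 0 < r → (r : ℂ) • ampl n unit + x ∈ cone n) → x ∈ cone n

/-- An operator `A`-system structure on `V`. Here `left a x` is `a · x` and `right a x` is
`x · a`; both are bilinear over `ℂ`. -/
structure OperatorASystem (A : Type a) [CStarAlgebra A] (V : Type u) [AddCommGroup V] [Module ℂ V]
    extends OperatorSystem V where
  left : A →ₗ[ℂ] V →ₗ[ℂ] V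
  right : A →ₗ[ℂ] V →ₗ[ℂ] V
  left_right : ∀ a b x, right b (left a x) = left a (right b x)
  left_mul : ∀ a b x, left (a * b) x = left a (left b x)
  right_mul : ∀ a b x, right (a * b) x = right b (right a x)
  one_left : ∀ x, left 1 x = x
  one_right : ∀ x, right 1 x = x
  adj_left : ∀ a x, adj (left a x) = right (star a) (adj x)
  left_unit : ∀ a, left a unit = right a unit
  /-- `[a_{ij}] · [s_{ij}] · [a_{ij}]*` is positive if `[s_{ij}]` is -/
  module_conj : ∀ {m n} (B : Matrix (Fin m) (Fin n) A) {x : Matrix (Fin n) (Fin n) V},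
    x ∈ cone n →
      Matrix.of (fun i j => ∑ k, ∑ l, right (star (B j l)) (left (B i k) (x k l))) ∈ cone m

section maps

variable {V : Type u} [AddCommGroup V] [Module ℂ V]
variable {W : Type v} [AddCommGroup W] [Module ℂ W]

/-- Complete positivity of a linear map. -/
def IsCP (𝒱 : OperatorSystem V) (𝒲 : OperatorSystem W) (φ : V →ₗ[ℂ] W) : Prop :=
  ∀ (n : ℕ) (x : Matrix (Fin n) (Fin n) V), x ∈ 𝒱.cone n → x.map φ ∈ 𝒲.cone n

/-- Unital completely positive maps. -/
structure IsUCP (𝒱 : OperatorSystem V) (𝒲 : OperatorSystem W) (φ : V →ₗ[ℂ] W) : Prop where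
  unital : φ 𝒱.unit = 𝒲.unit
  cp : IsCP 𝒱 𝒲 φ

/-- Complete order embeddings: complete order isomorphisms onto the range. -/
def IsCOE (𝒱 : OperatorSystem V) (𝒲 : OperatorSystem W) (φ : V →ₗ[ℂ] W) : Prop :=
  Function.Injective φ ∧
    ∀ (n : ℕ) (x : Matrix (Fin n) (Fin n) V), x ∈ 𝒱.cone n ↔ x.map φ ∈ 𝒲.cone n

/-- Complete order isomorphisms: completely positive bijections with completely positive
inverse. -/
def IsCOI (𝒱 : OperatorSystem V) (𝒲 : OperatorSystem W) (φ : V ≃ₗ[ℂ] W) : Prop :=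
  IsCP 𝒱 𝒲 φ ∧ IsCP 𝒲 𝒱 φ.symm

/-- `A`-bimodule maps. -/
def IsBimoduleMap {A : Type a} [CStarAlgebra A] (𝒱 : OperatorASystem A V)
    (𝒲 : OperatorASystem A W) (φ : V →ₗ[ℂ] W) : Prop :=
  ∀ (a₁ a₂ : A) (x : V), φ (𝒱.right a₂ (𝒱.left a₁ x)) = 𝒲.right a₂ (𝒲.left a₁ (φ x))

/-- Faithful operator `A`-systems. -/
def OperatorASystem.IsFaithful {A : Type a} [CStarAlgebra A] (𝒱 : OperatorASystem A V) : Prop :=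
  ∀ a : A, a ≠ 0 → 𝒱.left a 𝒱.unit ≠ 0

/-- `J` is a kernel in the operator system `V`. -/
def IsKernel (𝒱 : OperatorSystem V) (J : Submodule ℂ V) : Prop :=
  ∃ (W : Type u) (_ : AddCommGroup W) (_ : Module ℂ W) (𝒲 : OperatorSystem W) (φ : V →ₗ[ℂ] W),
    IsUCP 𝒱 𝒲 φ ∧ J = LinearMap.ker φ

end maps

section directSum

variable {V : Type u} [AddCommGroup V] [Module ℂ V]
variable {W : Type v} [AddCommGroup W] [Module ℂ W]

/-- The direct sum `V ⊕ W` of operator systems: everything is defined coordinatewise. -/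
def OperatorSystem.prod (𝒱 : OperatorSystem V) (𝒲 : OperatorSystem W) :
    OperatorSystem (V × W) where
  adj :=
    { toFun := fun x => (𝒱.adj x.1, 𝒲.adj x.2)
      map_add' := fun x y => by simp
      map_smul' := fun c x => by simp }
  adj_adj x := by simp [𝒱.adj_adj, 𝒲.adj_adj]
  cone n := {x | x.map Prod.fst ∈ 𝒱.cone n ∧ x.map Prod.snd ∈ 𝒲.cone n}
  cone_nonempty n := by
    obtain ⟨x, hx⟩ := 𝒱.cone_nonempty n
    obtain ⟨y, hy⟩ := 𝒲.cone_nonempty n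
    exact ⟨Matrix.of fun i j => (x i j, y i j), hx, hy⟩
  cone_hermitian hx i j :=
    Prod.ext (𝒱.cone_hermitian hx.1 i j) (𝒲.cone_hermitian hx.2 i j)
  cone_add hx hy := ⟨𝒱.cone_add hx.1 hy.1, 𝒲.cone_add hx.2 hy.2⟩
  cone_smul hr hx := ⟨𝒱.cone_smul hr hx.1, 𝒲.cone_smul hr hx.2⟩
  cone_proper {n x} hx hy := by
    have h1 := 𝒱.cone_proper hx.1 hy.1
    have h2 := 𝒲.cone_proper hx.2 hy.2
    ext i j
    · exact congrFun (congrFun h1 i) j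
    · exact congrFun (congrFun h2 i) j
  cone_conj {m n} X x hx := by
    have h1 := 𝒱.cone_conj X hx.1
    have h2 := 𝒲.cone_conj X hx.2
    refine ⟨?_, ?_⟩
    · convert h1 using 1
      ext i j
      simp [scalarConj, Prod.fst_sum]
    · convert h2 using 1
      ext i j
      simp [scalarConj, Prod.snd_sum]
  unit := (𝒱.unit, 𝒲.unit)
  adj_unit := by simp [𝒱.adj_unit, 𝒲.adj_unit]
  order_unit {n x} hx := by
    have hd1 : (ampl n (𝒱.unit, 𝒲.unit)).map Prod.fst = ampl n 𝒱.unit := by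
      ext i j
      by_cases h : i = j <;> simp [ampl, Matrix.diagonal, h]
    have hd2 : (ampl n (𝒱.unit, 𝒲.unit)).map Prod.snd = ampl n 𝒲.unit := by
      ext i j
      by_cases h : i = j <;> simp [ampl, Matrix.diagonal, h]
    have hx1 : 𝒱.IsHermitian (x.map Prod.fst) := fun i j => congrArg Prod.fst (hx i j)
    have hx2 : 𝒲.IsHermitian (x.map Prod.snd) := fun i j => congrArg Prod.snd (hx i j)
    obtain ⟨r, hr, h1⟩ := 𝒱.order_unit hx1
    obtain ⟨s, hs, h2⟩ := 𝒲.order_unit hx2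
    have hu1 : ampl n 𝒱.unit ∈ 𝒱.cone n := by
      have h0 := 𝒱.archimedean (n := n) (x := ampl n 𝒱.unit)
      refine h0 (fun i j => ?_) fun t ht => ?_
      · by_cases h : i = j <;> simp [ampl, Matrix.diagonal, h, 𝒱.adj_unit, eq_comm]
      · obtain ⟨q, hq, hm⟩ := 𝒱.order_unit (n := n) (x := 0) (fun i j => by simp)
        have := 𝒱.cone_smul (r := (t + 1) / q) (by positivity) hm
        convert this using 1
        rw [sub_zero, smul_smul]
        have : (((t + 1) / q : ℝ) : ℂ) * (q : ℂ) = (t : ℂ) + 1 := by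
          have : (q : ℂ) ≠ 0 := by exact_mod_cast hq.ne'
          push_cast
          field_simp
        rw [this, add_smul, one_smul]
    have hu2 : ampl n 𝒲.unit ∈ 𝒲.cone n := by
      have h0 := 𝒲.archimedean (n := n) (x := ampl n 𝒲.unit)
      refine h0 (fun i j => ?_) fun t ht => ?_
      · by_cases h : i = j <;> simp [ampl, Matrix.diagonal, h, 𝒲.adj_unit, eq_comm]
      · obtain ⟨q, hq, hm⟩ := 𝒲.order_unit (n := n) (x := 0) (fun i j => by simp)
        have := 𝒲.cone_smul (r := (t + 1) / q) (by positivity) hm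
        convert this using 1
        rw [sub_zero, smul_smul]
        have : (((t + 1) / q : ℝ) : ℂ) * (q : ℂ) = (t : ℂ) + 1 := by
          have : (q : ℂ) ≠ 0 := by exact_mod_cast hq.ne'
          push_cast
          field_simp
        rw [this, add_smul, one_smul]
    refine ⟨r + s, by positivity, ?_, ?_⟩
    · have := 𝒱.cone_add h1 (𝒱.cone_smul hs.le hu1)
      convert this using 1
      rw [← hd1]
      ext i j
      simp [add_smul]
      abel
    · have := 𝒲.cone_add h2 (𝒲.cone_smul hr.le hu2)
      convert this using 1
      rw [← hd2]
      ext i j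
      simp [add_smul]
      abel
  archimedean {n x} hx h := by
    have hd1 : (ampl n (𝒱.unit, 𝒲.unit)).map Prod.fst = ampl n 𝒱.unit := by
      ext i j
      by_cases h : i = j <;> simp [ampl, Matrix.diagonal, h]
    have hd2 : (ampl n (𝒱.unit, 𝒲.unit)).map Prod.snd = ampl n 𝒲.unit := by
      ext i j
      by_cases h : i = j <;> simp [ampl, Matrix.diagonal, h]
    have hx1 : 𝒱.IsHermitian (x.map Prod.fst) := fun i j => congrArg Prod.fst (hx i j)
    have hx2 : 𝒲.IsHermitian (x.map Prod.snd) := fun i j => congrArg Prod.snd (hx i j)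
    refine ⟨𝒱.archimedean hx1 fun r hr => ?_, 𝒲.archimedean hx2 fun r hr => ?_⟩
    · rw [← hd1]
      exact (h r hr).1
    · rw [← hd2]
      exact (h r hr).2

/-- The direct sum of operator `A`-systems, with the coordinatewise actions. -/
noncomputable def OperatorASystem.prod {A : Type a} [CStarAlgebra A] (𝒱 : OperatorASystem A V)
    (𝒲 : OperatorASystem A W) : OperatorASystem A (V × W) where
  toOperatorSystem := 𝒱.toOperatorSystem.prod 𝒲.toOperatorSystem
  left := LinearMap.mk₂ ℂ (fun a x => (𝒱.left a x.1, 𝒲.left a x.2))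
    (by intros; simp) (by intros; simp) (by intros; simp) (by intros; simp)
  right := LinearMap.mk₂ ℂ (fun a x => (𝒱.right a x.1, 𝒲.right a x.2))
    (by intros; simp) (by intros; simp) (by intros; simp) (by intros; simp)
  left_right a b x := by simp [𝒱.left_right, 𝒲.left_right]
  left_mul a b x := by simp [𝒱.left_mul, 𝒲.left_mul]
  right_mul a b x := by simp [𝒱.right_mul, 𝒲.right_mul]
  one_left x := by simp [𝒱.one_left, 𝒲.one_left]
  one_right x := by simp [𝒱.one_right, 𝒲.one_right]
  adj_left a x := Prod.ext (𝒱.adj_left a x.1) (𝒲.adj_left a x.2)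
  left_unit a := Prod.ext (𝒱.left_unit a) (𝒲.left_unit a)
  module_conj {m n} B x hx := by
    have h1 := 𝒱.module_conj B hx.1
    have h2 := 𝒲.module_conj B hx.2
    refine ⟨?_, ?_⟩
    · convert h1 using 1
      ext i j
      simp [Prod.fst_sum]
    · convert h2 using 1
      ext i j
      simp [Prod.snd_sum]

/-- The subspace `{a ⊕ (-a) : a ∈ A}` of `V ⊕ W`, where `a` stands for `a · e`. -/
noncomputable def antidiagonal {A : Type a} [CStarAlgebra A] (𝒱 : OperatorASystem A V)
    (𝒲 : OperatorASystem A W) : Submodule ℂ (V × W) :=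
  LinearMap.range ((𝒱.left.flip 𝒱.unit).prod (-(𝒲.left.flip 𝒲.unit)))

end directSum

section quotient

variable {V : Type u} [AddCommGroup V] [Module ℂ V]
variable {W : Type v} [AddCommGroup W] [Module ℂ W]

/-- The sets `D_n` of the matrices over `V / J` that lift to a positive matrix over `V`. -/
def quotientPreCone (𝒱 : OperatorSystem V) (J : Submodule ℂ V) (n : ℕ) :
    Set (Matrix (Fin n) (Fin n) (V ⧸ J)) :=
  {y | ∃ x ∈ 𝒱.cone n, x.map J.mkQ = y}

/-- The cones `C_n` of the quotient operator system: the matrices `y` over `V / J` such that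
`ε e_n + y ∈ D_n` for all `ε > 0`. -/
def quotientCone (𝒱 : OperatorSystem V) (J : Submodule ℂ V) (n : ℕ) :
    Set (Matrix (Fin n) (Fin n) (V ⧸ J)) :=
  {y | ∀ ε : ℝ, 0 < ε → (ε : ℂ) • ampl n (J.mkQ 𝒱.unit) + y ∈ quotientPreCone 𝒱 J n}

theorem ampl_map (n : ℕ) (φ : V →ₗ[ℂ] W) (e : V) : (ampl n e).map φ = ampl n (φ e) := by
  ext i j
  by_cases h : i = j <;> simp [ampl, Matrix.diagonal, h]

theorem scalarConj_map {m n : ℕ} (φ : V →ₗ[ℂ] W) (X : Matrix (Fin m) (Fin n) ℂ)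
    (x : Matrix (Fin n) (Fin n) V) : (scalarConj X x).map φ = scalarConj X (x.map φ) := by
  ext i j
  simp [scalarConj]

theorem scalarConj_add {m n : ℕ} (X : Matrix (Fin m) (Fin n) ℂ)
    (x y : Matrix (Fin n) (Fin n) V) :
    scalarConj X (x + y) = scalarConj X x + scalarConj X y := by
  ext i j
  simp [scalarConj, Finset.sum_add_distrib]

theorem scalarConj_smul {m n : ℕ} (X : Matrix (Fin m) (Fin n) ℂ) (c : ℂ)
    (x : Matrix (Fin n) (Fin n) V) :
    scalarConj X (c • x) = c • scalarConj X x := by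
  ext i j
  simp [scalarConj, Finset.smul_sum, smul_smul, mul_comm]

theorem OperatorSystem.ampl_hermitian (𝒱 : OperatorSystem V) (n : ℕ) :
    𝒱.IsHermitian (ampl n 𝒱.unit) := by
  intro i j
  by_cases h : i = j <;> simp [ampl, Matrix.diagonal, h, 𝒱.adj_unit, eq_comm]

theorem StarSpace.IsHermitian.scalarConj {𝒱 : StarSpace V} {m n : ℕ}
    (X : Matrix (Fin m) (Fin n) ℂ) {x : Matrix (Fin n) (Fin n) V} (hx : 𝒱.IsHermitian x) :
    𝒱.IsHermitian (scalarConj X x) := by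
  intro i j
  simp only [_root_.scalarConj, Matrix.of_apply, map_sum, LinearMap.map_smulₛₗ, hx _ _]
  rw [Finset.sum_comm]
  refine Finset.sum_congr rfl fun k _ => Finset.sum_congr rfl fun l _ => ?_
  simp [mul_comm]

theorem quotientPreCone_add {𝒱 : OperatorSystem V} {J : Submodule ℂ V} {n : ℕ}
    {x y : Matrix (Fin n) (Fin n) (V ⧸ J)} (hx : x ∈ quotientPreCone 𝒱 J n)
    (hy : y ∈ quotientPreCone 𝒱 J n) : x + y ∈ quotientPreCone 𝒱 J n := by
  obtain ⟨x', hx', rfl⟩ := hx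
  obtain ⟨y', hy', rfl⟩ := hy
  exact ⟨x' + y', 𝒱.cone_add hx' hy', by ext i j; simp⟩

theorem quotientPreCone_smul {𝒱 : OperatorSystem V} {J : Submodule ℂ V} {n : ℕ} {r : ℝ}
    (hr : 0 ≤ r) {x : Matrix (Fin n) (Fin n) (V ⧸ J)} (hx : x ∈ quotientPreCone 𝒱 J n) :
    (r : ℂ) • x ∈ quotientPreCone 𝒱 J n := by
  obtain ⟨x', hx', rfl⟩ := hx
  exact ⟨(r : ℂ) • x', 𝒱.cone_smul hr hx', by ext i j; simp⟩

theorem map_mem_quotientCone {𝒱 : OperatorSystem V} {J : Submodule ℂ V} {n : ℕ}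
    {x : Matrix (Fin n) (Fin n) V}
    (h : ∀ ε : ℝ, 0 < ε → (ε : ℂ) • ampl n 𝒱.unit + x ∈ 𝒱.cone n) :
    x.map J.mkQ ∈ quotientCone 𝒱 J n := by
  intro ε hε
  refine ⟨_, h ε hε, ?_⟩
  rw [← ampl_map]
  ext i j
  simp

theorem IsUCP.map_adj {𝒱 : OperatorSystem V} {𝒲 : OperatorSystem W} {φ : V →ₗ[ℂ] W}
    (hφ : IsUCP 𝒱 𝒲 φ) (x : V) : φ (𝒱.adj x) = 𝒲.adj (φ x) := by
  have key : ∀ y : V, 𝒱.adj y = y → 𝒲.adj (φ y) = φ y := by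
    intro y hy
    obtain ⟨r, -, h⟩ := 𝒱.order_unit (n := 1) (x := Matrix.of fun _ _ => y) (fun i j => hy)
    have := 𝒲.cone_hermitian (hφ.cp 1 _ h) 0 0
    simpa [ampl, hφ.unital, 𝒲.adj_unit, -Complex.coe_smul, LinearMap.map_smulₛₗ] using this
  have h1 := key (x + 𝒱.adj x) (by simp [𝒱.adj_adj, add_comm])
  have h2 := key (Complex.I • (x - 𝒱.adj x)) (by
    simp [𝒱.adj_adj, LinearMap.map_smulₛₗ, ← smul_neg])
  simp only [map_add, map_smul, map_sub, LinearMap.map_smulₛₗ, Complex.conj_I, neg_smul,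
    ← smul_neg] at h1 h2
  have h3 := smul_right_injective W Complex.I_ne_zero h2
  simp only [neg_sub] at h3
  have h4 : (2 : ℂ) • 𝒲.adj (φ x) = (2 : ℂ) • φ (𝒱.adj x) := by
    rw [two_smul, two_smul]
    have h5 := congrArg₂ (fun a b => a - b) h1 h3
    abel_nf at h5 ⊢
    simpa using h5
  exact (smul_right_injective W (two_ne_zero : (2 : ℂ) ≠ 0) h4).symm

theorem IsKernel.adj_mem {𝒱 : OperatorSystem V} {J : Submodule ℂ V} (hJ : IsKernel 𝒱 J) :
    J ≤ J.comap 𝒱.adj := by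
  obtain ⟨W, _, _, 𝒲, φ, hφ, rfl⟩ := hJ
  intro x hx
  simp only [Submodule.mem_comap, LinearMap.mem_ker] at hx ⊢
  rw [hφ.map_adj, hx, map_zero]

theorem IsKernel.proper {𝒱 : OperatorSystem V} {J : Submodule ℂ V} (hJ : IsKernel 𝒱 J) {n : ℕ}
    {y : Matrix (Fin n) (Fin n) (V ⧸ J)} (hy : y ∈ quotientCone 𝒱 J n)
    (hy' : -y ∈ quotientCone 𝒱 J n) : y = 0 := by
  obtain ⟨W, _, _, 𝒲, φ, hφ, rfl⟩ := hJ
  let ψ : (V ⧸ LinearMap.ker φ) →ₗ[ℂ] W := (LinearMap.ker φ).liftQ φ le_rfl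
  have hψ : Function.Injective ψ := by
    rw [← LinearMap.ker_eq_bot]
    exact Submodule.ker_liftQ_eq_bot _ _ _ le_rfl
  have key : ∀ z, z ∈ quotientCone 𝒱 (LinearMap.ker φ) n → z.map ψ ∈ 𝒲.cone n := by
    intro z hz
    have h1 : ∀ ε : ℝ, 0 < ε → (ε : ℂ) • ampl n 𝒲.unit + z.map ψ ∈ 𝒲.cone n := by
      intro ε hε
      obtain ⟨x, hx, hxz⟩ := hz ε hε
      have h2 := hφ.cp n x hx
      have h3 : x.map φ = (x.map (LinearMap.ker φ).mkQ).map ψ := by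
        ext i j
        simp [ψ]
      rw [h3, hxz] at h2
      convert h2 using 1
      rw [← hφ.unital]
      have : φ 𝒱.unit = ψ ((LinearMap.ker φ).mkQ 𝒱.unit) := by simp [ψ]
      rw [this, ← ampl_map]
      ext i j
      simp
    refine 𝒲.archimedean (fun i j => ?_) h1
    have h4 := 𝒲.cone_hermitian (h1 1 one_pos) i j
    have h5 := 𝒲.ampl_hermitian n i j
    simpa [h5] using h4
  have h := 𝒲.cone_proper (key y hy) (by
    convert key (-y) hy' using 1
    ext i j
    simp)
  ext i j
  apply hψ
  simpa using congrFun (congrFun h i) j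

/-- The quotient operator system of `V` by a kernel `J`. -/
def OperatorSystem.quotient (𝒱 : OperatorSystem V) (J : Submodule ℂ V) (hJ : IsKernel 𝒱 J) :
    OperatorSystem (V ⧸ J) where
  adj := J.mapQ J 𝒱.adj hJ.adj_mem
  adj_adj y := by
    obtain ⟨x, rfl⟩ := J.mkQ_surjective y
    simp [𝒱.adj_adj]
  cone := quotientCone 𝒱 J
  cone_nonempty n := by
    obtain ⟨r, hr, h⟩ := 𝒱.order_unit (n := n) (x := 0) (fun i j => by simp)
    refine ⟨(0 : Matrix (Fin n) (Fin n) V).map J.mkQ, map_mem_quotientCone fun ε hε => ?_⟩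
    have := 𝒱.cone_smul (r := ε / r) (by positivity) h
    convert this using 1
    rw [add_zero, sub_zero, smul_smul]
    have : (r : ℂ) ≠ 0 := by exact_mod_cast hr.ne'
    push_cast
    field_simp
  cone_hermitian {n y} hy i j := by
    obtain ⟨x, hx, hxy⟩ := hy 1 one_pos
    have h1 := 𝒱.cone_hermitian hx i j
    have h2 := 𝒱.ampl_hermitian n i j
    have h3 : y = (x - ampl n 𝒱.unit).map J.mkQ := by
      have : y = x.map J.mkQ - ampl n (J.mkQ 𝒱.unit) := by
        rw [hxy]
        simp
      rw [this, ← ampl_map]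
      ext i j
      simp
    rw [h3]
    simp [h1, h2]
  cone_add {n x y} hx hy ε hε := by
    have := quotientPreCone_add (hx (ε / 2) (by positivity)) (hy (ε / 2) (by positivity))
    convert this using 1
    have h : (ε : ℂ) = ((ε / 2 : ℝ) : ℂ) + ((ε / 2 : ℝ) : ℂ) := by push_cast; ring
    rw [h, add_smul]
    abel
  cone_smul {n r y} hr hy ε hε := by
    obtain ⟨q, hq, h0⟩ := 𝒱.order_unit (n := n) (x := 0) (fun i j => by simp)
    rcases hr.eq_or_lt with rfl | hr
    · have := 𝒱.cone_smul (r := ε / q) (by positivity) h0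
      refine ⟨_, this, ?_⟩
      rw [sub_zero, smul_smul, ← ampl_map]
      have h1 : (((ε / q : ℝ) : ℂ) * (q : ℂ)) = ε := by
        have : (q : ℂ) ≠ 0 := by exact_mod_cast hq.ne'
        push_cast
        field_simp
      rw [h1]
      ext i j
      simp
    · have := quotientPreCone_smul hr.le (hy (ε / r) (by positivity))
      convert this using 1
      rw [smul_add, smul_smul]
      have h1 : ((r : ℂ) * ((ε / r : ℝ) : ℂ)) = ε := by
        have : (r : ℂ) ≠ 0 := by exact_mod_cast hr.ne'
        push_cast
        field_simp
      rw [h1]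
  cone_proper hx hy := hJ.proper hx hy
  cone_conj {m n} X y hy ε hε := by
    obtain ⟨r, hr, h0⟩ := 𝒱.order_unit ((𝒱.ampl_hermitian n).scalarConj X)
    obtain ⟨x, hx, hxy⟩ := hy (ε / r) (by positivity)
    refine ⟨_, 𝒱.cone_add (𝒱.cone_conj X hx)
      (𝒱.cone_smul (r := ε / r) (by positivity) h0), ?_⟩
    have h1 : (((ε / r : ℝ) : ℂ) * (r : ℂ)) = ε := by
      have : (r : ℂ) ≠ 0 := by exact_mod_cast hr.ne'
      push_cast
      field_simp
    have h2 := scalarConj_map J.mkQ X x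
    rw [hxy, scalarConj_add, scalarConj_smul, ← ampl_map, ← scalarConj_map] at h2
    rw [smul_sub, smul_smul, h1, Matrix.map_add _ (map_add J.mkQ), h2, ← ampl_map]
    ext i j
    simp
    abel
  unit := J.mkQ 𝒱.unit
  adj_unit := by simp [𝒱.adj_unit]
  order_unit {n y} hy := by
    obtain ⟨x, rfl⟩ : ∃ x : Matrix (Fin n) (Fin n) V, x.map J.mkQ = y := by
      choose f hf using J.mkQ_surjective
      exact ⟨y.map f, by ext i j; simp only [Matrix.map_apply, hf]⟩
    let z : Matrix (Fin n) (Fin n) V :=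
      Matrix.of fun i j => (1 / 2 : ℂ) • (x i j + 𝒱.adj (x j i))
    have hz : 𝒱.IsHermitian z := by
      intro i j
      have h2 : (starRingEnd ℂ) 2 = 2 := Complex.conj_ofNat 2
      simp [z, 𝒱.adj_adj, LinearMap.map_smulₛₗ, add_comm, h2]
    have hzx : z.map J.mkQ = x.map J.mkQ := by
      ext i j
      have := hy i j
      simp only [Matrix.map_apply, Submodule.mkQ_apply, Submodule.mapQ_apply] at this
      simp only [z, Matrix.map_apply, Matrix.of_apply, map_smul, map_add, Submodule.mkQ_apply,
        this]
      rw [← two_smul ℂ, smul_smul]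
      norm_num
    obtain ⟨r, hr, h⟩ := 𝒱.order_unit hz
    refine ⟨r, hr, ?_⟩
    have h1 : (r : ℂ) • ampl n (J.mkQ 𝒱.unit) - x.map J.mkQ
        = ((r : ℂ) • ampl n 𝒱.unit - z).map J.mkQ := by
      rw [← hzx, ← ampl_map]
      ext i j
      simp
    rw [h1]
    refine map_mem_quotientCone fun ε hε => ?_
    obtain ⟨q, hq, h0⟩ := 𝒱.order_unit (n := n) (x := 0) (fun i j => by simp)
    have h2 := 𝒱.cone_add (𝒱.cone_smul (r := ε / q) (by positivity) h0) h
    convert h2 using 1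
    rw [sub_zero, smul_smul]
    have h1 : (((ε / q : ℝ) : ℂ) * (q : ℂ)) = ε := by
      have : (q : ℂ) ≠ 0 := by exact_mod_cast hq.ne'
      push_cast
      field_simp
    rw [h1]
  archimedean {n y} hy h ε hε := by
    have := h (ε / 2) (by positivity) (ε / 2) (by positivity)
    convert this using 1
    have h : (ε : ℂ) = ((ε / 2 : ℝ) : ℂ) + ((ε / 2 : ℝ) : ℂ) := by push_cast; ring
    rw [h, add_smul]
    abel

end quotient

/-- The operator `A`-system `P`, together with the maps `φ₁ : S → P` and `φ₂ : T → P`, is a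
coproduct of the operator `A`-systems `S` and `T`. The universal property is tested on all
operator `A`-systems in the universe `w`. -/
structure IsCoproduct {A : Type a} [CStarAlgebra A]
    {S : Type u} [AddCommGroup S] [Module ℂ S] {T : Type v} [AddCommGroup T] [Module ℂ T]
    {P : Type p} [AddCommGroup P] [Module ℂ P]
    (𝒮 : OperatorASystem A S) (𝒯 : OperatorASystem A T) (𝒢 : OperatorASystem A P)
    (φ₁ : S →ₗ[ℂ] P) (φ₂ : T →ₗ[ℂ] P) : Prop where
  faithful : 𝒢.IsFaithful
  unital₁ : φ₁ 𝒮.unit = 𝒢.unit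
  unital₂ : φ₂ 𝒯.unit = 𝒢.unit
  coe₁ : IsCOE 𝒮.toOperatorSystem 𝒢.toOperatorSystem φ₁
  coe₂ : IsCOE 𝒯.toOperatorSystem 𝒢.toOperatorSystem φ₂
  bimodule₁ : IsBimoduleMap 𝒮 𝒢 φ₁
  bimodule₂ : IsBimoduleMap 𝒯 𝒢 φ₂
  universal : ∀ (R : Type w) [AddCommGroup R] [Module ℂ R] (ℛ : OperatorASystem A R)
    (ψ₁ : S →ₗ[ℂ] R) (ψ₂ : T →ₗ[ℂ] R),
    IsUCP 𝒮.toOperatorSystem ℛ.toOperatorSystem ψ₁ → IsBimoduleMap 𝒮 ℛ ψ₁ →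
    IsUCP 𝒯.toOperatorSystem ℛ.toOperatorSystem ψ₂ → IsBimoduleMap 𝒯 ℛ ψ₂ →
    ∃! Ψ : P →ₗ[ℂ] R, (IsUCP 𝒢.toOperatorSystem ℛ.toOperatorSystem Ψ ∧ IsBimoduleMap 𝒢 ℛ Ψ) ∧
      Ψ ∘ₗ φ₁ = ψ₁ ∧ Ψ ∘ₗ φ₂ = ψ₂

/-! Faithfulness makes `a ↦ a · e` a complete order embedding of `A` into each system. Positive
matrices over `A` have the form `N* N`, so they map to positive matrices by the module axiom.
Conversely, if `M · e` is positive and `N` is the negative part of `M`, conjugation by `N` shows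
that `-(N³ · e)` is positive. As `N³ · e` is positive too, properness of the cone gives `N³ · e =
0`; faithfulness and the C*-identity then give `N = 0`. This is `nonneg_of_matrixUnit_mem_cone`: an
order inequality between matrices over `A` can be moved from one system to the other through `A`.

For any self-adjoint subspace `J`, the cones `C_n` on the quotient satisfy every axiom of an
operator system except possibly properness. If they are proper, `J` is the kernel of its own
quotient map. For the antidiagonal, suppose that `y`, the class of `(s, t)`, and `-y` both lie in
`C_n`. Then for every `ε` there are `M`, `N` over `A` with `s + M · e` and `-s + N · e` at least
`-ε` in `S`, and `t - M · e` and `-t - N · e` at least `-ε` in `T`. Adding and transferring to `A`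
gives `-2ε ≤ M + N ≤ 2ε`, so `s + M · e` and `t - M · e` lie between `-3ε` and `3ε`. As `ε` tends to
zero the matrices `M` form a Cauchy sequence in the C*-algebra `M_n(A)`. Its limit `L` satisfies `s
= -L · e` and `t = L · e`, so `y = 0`. This is `quotientCone_antidiagonal_proper`, the heart of the
proof.

The universal map is induced by `(s, t) ↦ (ψ₁ s + ψ₂ t) / 2`; the factor 2 in the inclusions
compensates for the half and makes them unital. That the inclusions reflect positivity is again the
transfer of inequalities through `A`. Uniqueness of universal objects gives the isomorphism with any
other coproduct. -/

/-! ### Order and norm in C*-algebras. -/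

section cstar

theorem CStarAlgebra.eq_zero_of_mul_mul_self {B : Type*} [NonUnitalCStarAlgebra B] {x : B}
    (hx : IsSelfAdjoint x) (h : x * x * x = 0) : x = 0 := by
  have h1 : star (x * x) * (x * x) = 0 := by
    rw [star_mul, hx.star_eq, ← mul_assoc, h, zero_mul]
  have h2 : star x * x = 0 := by
    rw [hx.star_eq]
    exact CStarRing.star_mul_self_eq_zero_iff _ |>.1 h1
  exact CStarRing.star_mul_self_eq_zero_iff _ |>.1 h2

variable {B : Type*} [CStarAlgebra B] [PartialOrder B] [StarOrderedRing B]

theorem CStarAlgebra.norm_le_of_nonneg_smul_one_add_of_nonneg_smul_one_sub {x : B} {r : ℝ}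
    (hr : 0 ≤ r) (h₁ : 0 ≤ (r : ℂ) • (1 : B) + x) (h₂ : 0 ≤ (r : ℂ) • (1 : B) - x) :
    ‖x‖ ≤ r := by
  have hone : (r : ℂ) • (1 : B) = algebraMap ℝ B r := by
    rw [Complex.coe_smul, Algebra.algebraMap_eq_smul_one]
  rw [hone] at h₁ h₂
  have hx : IsSelfAdjoint x := by
    have := (IsSelfAdjoint.of_nonneg h₁).sub
      ((IsSelfAdjoint.all r).algebraMap B)
    simpa using this
  rcases subsingleton_or_nontrivial B with _ | _
  · simpa [Subsingleton.elim x 0] using hr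
  have h₁' : algebraMap ℝ B (-r) ≤ x := by
    rw [map_neg, neg_le_iff_add_nonneg']
    exact h₁
  rcases CStarAlgebra.norm_or_neg_norm_mem_spectrum hx with h | h
  · exact (le_algebraMap_iff_spectrum_le hx).1 (sub_nonneg.1 h₂) _ h
  · linarith [(algebraMap_le_iff_le_spectrum hx).1 h₁' _ h]

theorem CStarAlgebra.exists_eq_star_mul_self {x : B} (hx : 0 ≤ x) : ∃ y, x = star y * y :=
  CStarAlgebra.nonneg_iff_eq_star_mul_self.1 hx

/-- The witness is the negative part, which annihilates the positive part. Conjugation by it is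
available in any operator `A`-system, so positivity can be tested there without functional calculus
on the system. -/
theorem IsSelfAdjoint.exists_nonneg_conj_eq_neg {x : B} (hx : IsSelfAdjoint x) :
    ∃ y : B, 0 ≤ y ∧ y * x * y = -(y * y * y) ∧ (y = 0 → 0 ≤ x) := by
  have hdec := CFC.posPart_sub_negPart x hx
  refine ⟨x⁻, CFC.negPart_nonneg x, ?_, fun h => ?_⟩
  · have h : x⁻ * (x⁺ - x⁻) = -(x⁻ * x⁻) := by
      rw [mul_sub, CFC.negPart_mul_posPart, zero_sub]
    rw [hdec] at h
    rw [h, neg_mul]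
  · rw [h, sub_zero] at hdec
    rw [← hdec]
    exact CFC.posPart_nonneg x

end cstar

/-! ### Elementary consequences of the Archimedean order unit. -/

namespace OperatorSystem

variable {V : Type u} [AddCommGroup V] [Module ℂ V] (𝒱 : OperatorSystem V)

theorem zero_mem_cone (n : ℕ) : (0 : Matrix (Fin n) (Fin n) V) ∈ 𝒱.cone n := by
  obtain ⟨x, hx⟩ := 𝒱.cone_nonempty n
  simpa using 𝒱.cone_smul le_rfl hx

theorem ampl_mem_cone (n : ℕ) : ampl n 𝒱.unit ∈ 𝒱.cone n := by
  obtain ⟨r, hr, h⟩ := 𝒱.order_unit (n := n) (x := 0) (fun i j => by simp)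
  have := 𝒱.cone_smul (r := r⁻¹) (by positivity) h
  rw [sub_zero, smul_smul] at this
  have h1 : ((r⁻¹ : ℝ) : ℂ) * (r : ℂ) = 1 := by
    have : (r : ℂ) ≠ 0 := by exact_mod_cast hr.ne'
    push_cast
    field_simp
  rwa [h1, one_smul] at this

variable {𝒱}

theorem smul_ampl_add_mem_cone {n : ℕ} {x : Matrix (Fin n) (Fin n) V} (hx : x ∈ 𝒱.cone n) {r : ℝ}
    (hr : 0 ≤ r) : (r : ℂ) • ampl n 𝒱.unit + x ∈ 𝒱.cone n :=
  𝒱.cone_add (𝒱.cone_smul hr (𝒱.ampl_mem_cone n)) hx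

/-- Hermitianness, which the Archimedean axiom asks for, is automatic: the perturbation with
coefficient 1 lies in the cone and the unit is hermitian. The constant `c` absorbs multiples of the
error arising from sums of estimates. -/
theorem mem_cone_of_forall_smul_ampl_add {n : ℕ} {x : Matrix (Fin n) (Fin n) V} {c : ℝ}
    (hc : 0 < c) (h : ∀ r : ℝ, 0 < r → ((c * r : ℝ) : ℂ) • ampl n 𝒱.unit + x ∈ 𝒱.cone n) :
    x ∈ 𝒱.cone n := by
  have h' : ∀ r : ℝ, 0 < r → (r : ℂ) • ampl n 𝒱.unit + x ∈ 𝒱.cone n := by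
    intro r hr
    have := h (r / c) (by positivity)
    rwa [mul_div_cancel₀ _ hc.ne'] at this
  refine 𝒱.archimedean (fun i j => ?_) h'
  have h1 := 𝒱.cone_hermitian (h' 1 one_pos) i j
  have h2 := 𝒱.ampl_hermitian n i j
  simpa [h2] using h1

end OperatorSystem

/-! ### The copy of `M_n(A)` inside `M_n(V)`. -/

namespace OperatorASystem

variable {A : Type a} [CStarAlgebra A]
variable {V : Type u} [AddCommGroup V] [Module ℂ V]
variable (𝒱 : OperatorASystem A V)

/-- The map `M_n(A) → M_n(V)` induced by `a ↦ a · e`. -/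
noncomputable def matrixUnit (n : ℕ) : Matrix (Fin n) (Fin n) A →ₗ[ℂ] Matrix (Fin n) (Fin n) V :=
  (𝒱.left.flip 𝒱.unit).mapMatrix

@[simp]
theorem matrixUnit_apply {n : ℕ} (M : Matrix (Fin n) (Fin n) A) (i j : Fin n) :
    𝒱.matrixUnit n M i j = 𝒱.left (M i j) 𝒱.unit := rfl

theorem matrixUnit_one (n : ℕ) : 𝒱.matrixUnit n 1 = ampl n 𝒱.unit := by
  ext i j
  by_cases h : i = j <;> simp [ampl, Matrix.diagonal, h, 𝒱.one_left]

theorem adj_left_unit (a : A) : 𝒱.adj (𝒱.left a 𝒱.unit) = 𝒱.left (star a) 𝒱.unit := by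
  rw [𝒱.adj_left, 𝒱.adj_unit, 𝒱.left_unit]

theorem right_left_unit (a b : A) :
    𝒱.right b (𝒱.left a 𝒱.unit) = 𝒱.left (a * b) 𝒱.unit := by
  rw [𝒱.left_right, ← 𝒱.left_unit, 𝒱.left_mul]

/-- Because `a · e = e · a`, right multipliers can be absorbed into the coefficient, so the module
conjugation becomes ordinary matrix multiplication over `A`. -/
theorem matrixUnit_conj {m n : ℕ} (B : Matrix (Fin m) (Fin n) A) (M : Matrix (Fin n) (Fin n) A) :
    Matrix.of (fun i j => ∑ k, ∑ l,
      𝒱.right (star (B j l)) (𝒱.left (B i k) (𝒱.matrixUnit n M k l))) =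
      𝒱.matrixUnit m (B * M * B.conjTranspose) := by
  ext i j
  simp only [Matrix.of_apply, matrixUnit_apply, ← 𝒱.left_mul, 𝒱.right_left_unit,
    Matrix.mul_apply, Matrix.conjTranspose_apply, Finset.sum_mul, map_sum, LinearMap.sum_apply]
  exact Finset.sum_comm

theorem matrixUnit_conj_mem_cone {m n : ℕ} (B : Matrix (Fin m) (Fin n) A)
    {M : Matrix (Fin n) (Fin n) A} (hM : 𝒱.matrixUnit n M ∈ 𝒱.cone n) :
    𝒱.matrixUnit m (B * M * B.conjTranspose) ∈ 𝒱.cone m := by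
  rw [← matrixUnit_conj]
  exact 𝒱.module_conj B hM

variable {𝒱}

theorem IsFaithful.left_unit_injective (h : 𝒱.IsFaithful) {a b : A}
    (hab : 𝒱.left a 𝒱.unit = 𝒱.left b 𝒱.unit) : a = b := by
  by_contra hne
  exact h (a - b) (sub_ne_zero.2 hne) (by simp [hab])

theorem IsFaithful.matrixUnit_injective (h : 𝒱.IsFaithful) (n : ℕ) :
    Function.Injective (𝒱.matrixUnit n) := by
  intro M N hMN
  ext i j
  exact h.left_unit_injective (congrFun (congrFun hMN i) j)

variable [PartialOrder A] [StarOrderedRing A]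

/-- A positive matrix is `N* 1 N`, and `1` corresponds to the matrix order unit. Faithfulness plays
no role in this direction. -/
theorem matrixUnit_mem_cone {n : ℕ} {M : CStarMatrix (Fin n) (Fin n) A} (hM : 0 ≤ M) :
    𝒱.matrixUnit n (CStarMatrix.ofMatrix.symm M) ∈ 𝒱.cone n := by
  obtain ⟨N, rfl⟩ := CStarAlgebra.exists_eq_star_mul_self hM
  have := 𝒱.matrixUnit_conj_mem_cone
    (CStarMatrix.ofMatrix.symm (star N)) (M := 1) (by
      rw [matrixUnit_one]; exact 𝒱.ampl_mem_cone n)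
  rw [Matrix.mul_one] at this
  convert this using 2
  ext i j
  simp [CStarMatrix.mul_apply, Matrix.mul_apply, CStarMatrix.star_apply]

/-- In a faithful operator `A`-system, `a ↦ a · e` reflects positivity of matrices. -/
theorem IsFaithful.nonneg_of_matrixUnit_mem_cone (h : 𝒱.IsFaithful) {n : ℕ}
    {M : CStarMatrix (Fin n) (Fin n) A}
    (hM : 𝒱.matrixUnit n (CStarMatrix.ofMatrix.symm M) ∈ 𝒱.cone n) : 0 ≤ M := by
  have hsa : IsSelfAdjoint M := by
    ext i j
    have := 𝒱.cone_hermitian hM i j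
    rw [matrixUnit_apply, adj_left_unit] at this
    exact h.left_unit_injective this
  -- `N` is the negative part of `M`; the aim is `N = 0`, which follows once both `N³ · e` and its
  -- negative are seen to be positive.
  obtain ⟨N, hN, hconj, hM0⟩ := hsa.exists_nonneg_conj_eq_neg
  have hNsa : IsSelfAdjoint N := .of_nonneg hN
  have hcube : 0 ≤ N * N * N := by
    simpa [hNsa.star_eq] using star_left_conjugate_nonneg hN N
  have h₁ : 𝒱.matrixUnit n (CStarMatrix.ofMatrix.symm (N * M * N)) ∈ 𝒱.cone n := by
    have := 𝒱.matrixUnit_conj_mem_cone (CStarMatrix.ofMatrix.symm N) hM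
    convert this using 2
    have h2 : N * M * N = N * M * star N := by rw [hNsa.star_eq]
    rw [h2]
    rfl
  have h₂ : -𝒱.matrixUnit n (CStarMatrix.ofMatrix.symm (N * N * N)) ∈ 𝒱.cone n := by
    rw [hconj] at h₁
    rw [← map_neg]
    exact h₁
  have h₃ := 𝒱.cone_proper (matrixUnit_mem_cone hcube) h₂
  have h₄ : N * N * N = 0 := h.matrixUnit_injective n (h₃.trans (map_zero _).symm)
  exact hM0 (CStarAlgebra.eq_zero_of_mul_mul_self hNsa h₄)

end OperatorASystem

open Filter Topology

/-! ### Quotients by subspaces whose quotient cones are proper. -/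

section quotientOfProper

variable {V : Type u} [AddCommGroup V] [Module ℂ V]

theorem exists_matrix_map_mkQ (J : Submodule ℂ V) {n : ℕ}
    (y : Matrix (Fin n) (Fin n) (V ⧸ J)) :
    ∃ x : Matrix (Fin n) (Fin n) V, x.map J.mkQ = y := by
  choose f hf using J.mkQ_surjective
  exact ⟨y.map f, by ext i j; simp only [Matrix.map_apply, hf]⟩

theorem map_mkQ_mem_quotientCone {𝒱 : OperatorSystem V} (J : Submodule ℂ V) {n : ℕ}
    {x : Matrix (Fin n) (Fin n) V} (hx : x ∈ 𝒱.cone n) : x.map J.mkQ ∈ quotientCone 𝒱 J n :=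
  map_mem_quotientCone fun _ hε => OperatorSystem.smul_ampl_add_mem_cone hx hε.le

theorem quotientCone_add {𝒱 : OperatorSystem V} {J : Submodule ℂ V} {n : ℕ}
    {x y : Matrix (Fin n) (Fin n) (V ⧸ J)} (hx : x ∈ quotientCone 𝒱 J n)
    (hy : y ∈ quotientCone 𝒱 J n) : x + y ∈ quotientCone 𝒱 J n := by
  intro ε hε
  have := quotientPreCone_add (hx (ε / 2) (by positivity)) (hy (ε / 2) (by positivity))
  convert this using 1
  have h : (ε : ℂ) = ((ε / 2 : ℝ) : ℂ) + ((ε / 2 : ℝ) : ℂ) := by push_cast; ring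
  rw [h, add_smul]
  abel

theorem quotientCone_smul {𝒱 : OperatorSystem V} {J : Submodule ℂ V} {n : ℕ} {r : ℝ}
    (hr : 0 ≤ r) {y : Matrix (Fin n) (Fin n) (V ⧸ J)} (hy : y ∈ quotientCone 𝒱 J n) :
    (r : ℂ) • y ∈ quotientCone 𝒱 J n := by
  intro ε hε
  rcases hr.eq_or_lt with rfl | hr
  · refine ⟨_, 𝒱.cone_smul hε.le (𝒱.ampl_mem_cone n), ?_⟩
    rw [← ampl_map]
    ext i j
    simp
  · have := quotientPreCone_smul hr.le (hy (ε / r) (by positivity))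
    rwa [smul_add, smul_smul, ← Complex.ofReal_mul, mul_div_cancel₀ _ hr.ne'] at this

theorem quotientCone_archimedean {𝒱 : OperatorSystem V} {J : Submodule ℂ V} {n : ℕ}
    {y : Matrix (Fin n) (Fin n) (V ⧸ J)}
    (h : ∀ r : ℝ, 0 < r → (r : ℂ) • ampl n (J.mkQ 𝒱.unit) + y ∈ quotientCone 𝒱 J n) :
    y ∈ quotientCone 𝒱 J n := by
  intro ε hε
  have := h (ε / 2) (by positivity) (ε / 2) (by positivity)
  convert this using 1
  have h : (ε : ℂ) = ((ε / 2 : ℝ) : ℂ) + ((ε / 2 : ℝ) : ℂ) := by push_cast; ring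
  rw [h, add_smul]
  abel

theorem scalarConj_mem_quotientCone {𝒱 : OperatorSystem V} {J : Submodule ℂ V} {m n : ℕ}
    (X : Matrix (Fin m) (Fin n) ℂ) {y : Matrix (Fin n) (Fin n) (V ⧸ J)}
    (hy : y ∈ quotientCone 𝒱 J n) : scalarConj X y ∈ quotientCone 𝒱 J m := by
  intro ε hε
  -- `r e_m` dominates `X e_n X*`, so an error `ε / r` before conjugation costs at most `ε` after
  -- it.
  obtain ⟨r, hr, h0⟩ := 𝒱.order_unit ((𝒱.ampl_hermitian n).scalarConj X)
  obtain ⟨x, hx, hxy⟩ := hy (ε / r) (by positivity)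
  refine ⟨_, 𝒱.cone_add (𝒱.cone_conj X hx)
    (𝒱.cone_smul (r := ε / r) (by positivity) h0), ?_⟩
  have h2 := scalarConj_map J.mkQ X x
  rw [hxy, scalarConj_add, scalarConj_smul, ← ampl_map, ← scalarConj_map] at h2
  rw [smul_sub, smul_smul, ← Complex.ofReal_mul, div_mul_cancel₀ _ hr.ne',
    Matrix.map_add _ (map_add J.mkQ), h2, ← ampl_map]
  ext i j
  simp
  abel

theorem quotientCone_hermitian {𝒱 : OperatorSystem V} {J : Submodule ℂ V}
    (hadj : J ≤ J.comap 𝒱.adj) {n : ℕ} {y : Matrix (Fin n) (Fin n) (V ⧸ J)}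
    (hy : y ∈ quotientCone 𝒱 J n) (i j : Fin n) : J.mapQ J 𝒱.adj hadj (y j i) = y i j := by
  obtain ⟨x, hx, hxy⟩ := hy 1 one_pos
  have h1 := 𝒱.cone_hermitian hx i j
  have h2 := 𝒱.ampl_hermitian n i j
  have h3 : y = (x - ampl n 𝒱.unit).map J.mkQ := by
    have : y = x.map J.mkQ - ampl n (J.mkQ 𝒱.unit) := by
      rw [hxy]
      simp
    rw [this, ← ampl_map]
    ext i j
    simp
  rw [h3]
  simp [h1, h2]

theorem quotientCone_order_unit {𝒱 : OperatorSystem V} {J : Submodule ℂ V}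
    (hadj : J ≤ J.comap 𝒱.adj) {n : ℕ} {y : Matrix (Fin n) (Fin n) (V ⧸ J)}
    (hy : ∀ i j, J.mapQ J 𝒱.adj hadj (y j i) = y i j) :
    ∃ r : ℝ, 0 < r ∧ (r : ℂ) • ampl n (J.mkQ 𝒱.unit) - y ∈ quotientCone 𝒱 J n := by
  obtain ⟨x, rfl⟩ := exists_matrix_map_mkQ J y
  -- A lift of a hermitian matrix need not be hermitian; its hermitian part is, and has the same
  -- image.
  let z : Matrix (Fin n) (Fin n) V :=
    Matrix.of fun i j => (1 / 2 : ℂ) • (x i j + 𝒱.adj (x j i))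
  have hz : 𝒱.IsHermitian z := by
    intro i j
    have h2 : (starRingEnd ℂ) 2 = 2 := Complex.conj_ofNat 2
    simp [z, 𝒱.adj_adj, LinearMap.map_smulₛₗ, add_comm, h2]
  have hzx : z.map J.mkQ = x.map J.mkQ := by
    ext i j
    have := hy i j
    simp only [Matrix.map_apply, Submodule.mkQ_apply, Submodule.mapQ_apply] at this
    simp only [z, Matrix.map_apply, Matrix.of_apply, map_smul, map_add, Submodule.mkQ_apply,
      this]
    rw [← two_smul ℂ, smul_smul]
    norm_num
  obtain ⟨r, hr, h⟩ := 𝒱.order_unit hz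
  refine ⟨r, hr, ?_⟩
  have h1 : (r : ℂ) • ampl n (J.mkQ 𝒱.unit) - x.map J.mkQ
      = ((r : ℂ) • ampl n 𝒱.unit - z).map J.mkQ := by
    rw [← hzx, ← ampl_map]
    ext i j
    simp
  rw [h1]
  exact map_mkQ_mem_quotientCone J h

/-- The operator system structure on `V / J` given by the quotient cones, when `J` is self-adjoint
and these cones are proper. -/
def OperatorSystem.quotientOfProper (𝒱 : OperatorSystem V) (J : Submodule ℂ V)
    (hadj : J ≤ J.comap 𝒱.adj)
    (hproper : ∀ (n : ℕ) (y : Matrix (Fin n) (Fin n) (V ⧸ J)),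
      y ∈ quotientCone 𝒱 J n → -y ∈ quotientCone 𝒱 J n → y = 0) :
    OperatorSystem (V ⧸ J) where
  adj := J.mapQ J 𝒱.adj hadj
  adj_adj y := by
    obtain ⟨x, rfl⟩ := J.mkQ_surjective y
    simp [𝒱.adj_adj]
  cone := quotientCone 𝒱 J
  cone_nonempty n := ⟨_, map_mkQ_mem_quotientCone J (𝒱.ampl_mem_cone n)⟩
  cone_hermitian hy := quotientCone_hermitian hadj hy
  cone_add := quotientCone_add
  cone_smul hr hy := quotientCone_smul hr hy
  cone_proper hy hy' := hproper _ _ hy hy'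
  cone_conj := scalarConj_mem_quotientCone
  unit := J.mkQ 𝒱.unit
  adj_unit := by simp [𝒱.adj_unit]
  order_unit := quotientCone_order_unit hadj
  archimedean _ h := quotientCone_archimedean h

/-- `OperatorSystem.quotient` already presupposes a kernel, so the target system is built from
properness instead; `J` is then the kernel of `mkQ`. -/
theorem isKernel_of_proper (𝒱 : OperatorSystem V) (J : Submodule ℂ V)
    (hadj : J ≤ J.comap 𝒱.adj)
    (hproper : ∀ (n : ℕ) (y : Matrix (Fin n) (Fin n) (V ⧸ J)),
      y ∈ quotientCone 𝒱 J n → -y ∈ quotientCone 𝒱 J n → y = 0) : IsKernel 𝒱 J :=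
  ⟨V ⧸ J, _, _, 𝒱.quotientOfProper J hadj hproper, J.mkQ,
    ⟨rfl, fun _ _ hx => map_mkQ_mem_quotientCone J hx⟩, J.ker_mkQ.symm⟩

end quotientOfProper

/-! ### Limits controlled by order estimates. -/

section limits

variable {B : Type*} [CStarAlgebra B] [PartialOrder B] [StarOrderedRing B]

/-- Exchanging `j` and `k` makes the estimate two-sided, hence a norm bound, so `f` is Cauchy. The
bounds on the limit come from letting `j` tend to infinity, since the positive cone is closed. -/
theorem CStarAlgebra.exists_limit_of_nonneg_smul_one_add_sub {f : ℕ → B} {r : ℕ → ℝ}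
    (hr : Tendsto r atTop (𝓝 0)) (hr0 : ∀ k, 0 ≤ r k)
    (h : ∀ j k, 0 ≤ ((r j + r k : ℝ) : ℂ) • (1 : B) + (f j - f k)) :
    ∃ b : B, ∀ k, 0 ≤ (r k : ℂ) • (1 : B) + (b - f k) ∧
      0 ≤ (r k : ℂ) • (1 : B) + (f k - b) := by
  have hnorm : ∀ j k, ‖f j - f k‖ ≤ r j + r k := fun j k =>
    norm_le_of_nonneg_smul_one_add_of_nonneg_smul_one_sub (add_nonneg (hr0 j) (hr0 k)) (h j k)
      (by simpa [sub_eq_add_neg, add_comm] using h k j)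
  have hcauchy : CauchySeq f := by
    rw [Metric.cauchySeq_iff]
    intro ε hε
    obtain ⟨N, hN⟩ := eventually_atTop.1 (hr.eventually_lt_const (half_pos hε))
    refine ⟨N, fun j hj k hk => ?_⟩
    rw [dist_eq_norm]
    linarith [hnorm j k, hN j hj, hN k hk]
  obtain ⟨b, hb⟩ := cauchySeq_tendsto_of_complete hcauchy
  refine ⟨b, fun k => ?_⟩
  have hrk : Tendsto (fun j => ((r j + r k : ℝ) : ℂ) • (1 : B)) atTop (𝓝 ((r k : ℂ) • 1)) := by
    have h1 : Tendsto (fun j => ((r j + r k : ℝ) : ℂ)) atTop (𝓝 ((0 + r k : ℝ) : ℂ)) :=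
      (Complex.continuous_ofReal.tendsto _).comp (hr.add_const _)
    rw [zero_add] at h1
    exact h1.smul_const _
  refine ⟨ge_of_tendsto' (hrk.add (hb.sub_const _)) fun j => h j k,
    ge_of_tendsto' (hrk.add (hb.const_sub _)) fun j => ?_⟩
  simpa [add_comm] using h k j

end limits

namespace OperatorASystem

variable {A : Type a} [CStarAlgebra A]
variable {V : Type u} [AddCommGroup V] [Module ℂ V]
variable {𝒱 : OperatorASystem A V}

theorem matrixUnit_smul_one_add {n : ℕ} (c : ℂ) (M : CStarMatrix (Fin n) (Fin n) A) :
    𝒱.matrixUnit n (CStarMatrix.ofMatrix.symm (c • 1 + M)) =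
      c • ampl n 𝒱.unit + 𝒱.matrixUnit n (CStarMatrix.ofMatrix.symm M) := by
  rw [← matrixUnit_one, ← map_smul, ← map_add]
  rfl

variable [PartialOrder A] [StarOrderedRing A]

theorem smul_ampl_add_matrixUnit_mem_cone {n : ℕ} {r : ℝ} {M : CStarMatrix (Fin n) (Fin n) A}
    (h : 0 ≤ (r : ℂ) • 1 + M) :
    (r : ℂ) • ampl n 𝒱.unit + 𝒱.matrixUnit n (CStarMatrix.ofMatrix.symm M) ∈ 𝒱.cone n := by
  rw [← matrixUnit_smul_one_add]
  exact matrixUnit_mem_cone h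

theorem IsFaithful.nonneg_of_smul_ampl_add_matrixUnit_mem_cone (h : 𝒱.IsFaithful) {n : ℕ} {r : ℝ}
    {M : CStarMatrix (Fin n) (Fin n) A}
    (hM : (r : ℂ) • ampl n 𝒱.unit + 𝒱.matrixUnit n (CStarMatrix.ofMatrix.symm M) ∈ 𝒱.cone n) :
    0 ≤ (r : ℂ) • 1 + M := by
  rw [← matrixUnit_smul_one_add] at hM
  exact h.nonneg_of_matrixUnit_mem_cone hM

/-- No norm on `V` is needed: `x + M k · e` is within `r k` of zero in the order and `L` is within
`r k` of `M k`, so `x + L · e` lies between `-2 r k` and `2 r k` times the unit. The Archimedean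
property and properness finish. -/
theorem add_matrixUnit_eq_zero_of_tendsto {n : ℕ} {x : Matrix (Fin n) (Fin n) V}
    {M : ℕ → CStarMatrix (Fin n) (Fin n) A} {L : CStarMatrix (Fin n) (Fin n) A} {r : ℕ → ℝ}
    (hr : Tendsto r atTop (𝓝 0))
    (h₁ : ∀ k, (r k : ℂ) • ampl n 𝒱.unit + (x + 𝒱.matrixUnit n (CStarMatrix.ofMatrix.symm (M k)))
      ∈ 𝒱.cone n)
    (h₂ : ∀ k, (r k : ℂ) • ampl n 𝒱.unit - (x + 𝒱.matrixUnit n (CStarMatrix.ofMatrix.symm (M k)))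
      ∈ 𝒱.cone n)
    (h₃ : ∀ k, 0 ≤ (r k : ℂ) • 1 + (L - M k)) (h₄ : ∀ k, 0 ≤ (r k : ℂ) • 1 + (M k - L)) :
    x + 𝒱.matrixUnit n (CStarMatrix.ofMatrix.symm L) = 0 := by
  have hsub : ∀ P Q : CStarMatrix (Fin n) (Fin n) A,
      𝒱.matrixUnit n (CStarMatrix.ofMatrix.symm (P - Q)) =
        𝒱.matrixUnit n (CStarMatrix.ofMatrix.symm P) -
          𝒱.matrixUnit n (CStarMatrix.ofMatrix.symm Q) := fun P Q => map_sub (𝒱.matrixUnit n) _ _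
  have key : ∀ y : Matrix (Fin n) (Fin n) V,
      (∀ k, ((r k + r k : ℝ) : ℂ) • ampl n 𝒱.unit + y ∈ 𝒱.cone n) → y ∈ 𝒱.cone n := by
    intro y hy
    refine OperatorSystem.mem_cone_of_forall_smul_ampl_add (c := 2) two_pos fun t ht => ?_
    obtain ⟨k, hk⟩ := (hr.eventually_lt_const ht).exists
    -- The error `2 r k` is topped up to `2 t`.
    have := 𝒱.smul_ampl_add_mem_cone (hy k) (r := 2 * (t - r k)) (by linarith)
    convert this using 1
    rw [← add_assoc, ← add_smul, ← Complex.ofReal_add]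
    ring_nf
  refine 𝒱.cone_proper (key _ fun k => ?_) (key _ fun k => ?_)
  · have := 𝒱.cone_add (h₁ k) (smul_ampl_add_matrixUnit_mem_cone (h₃ k))
    convert this using 1
    rw [hsub, Complex.ofReal_add, add_smul]
    abel
  · have := 𝒱.cone_add (h₂ k) (smul_ampl_add_matrixUnit_mem_cone (h₄ k))
    convert this using 1
    rw [hsub, Complex.ofReal_add, add_smul]
    abel

end OperatorASystem

/-! ### The antidiagonal copy of `A` is a kernel. -/

section antidiagonal

variable {A : Type a} [CStarAlgebra A]
variable {S : Type u} [AddCommGroup S] [Module ℂ S] {T : Type v} [AddCommGroup T] [Module ℂ T]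
variable {𝒮 : OperatorASystem A S} {𝒯 : OperatorASystem A T}

theorem mem_antidiagonal {x : S × T} :
    x ∈ antidiagonal 𝒮 𝒯 ↔ ∃ a : A, (𝒮.left a 𝒮.unit, -𝒯.left a 𝒯.unit) = x :=
  Iff.rfl

theorem antidiagonal_le_comap_adj :
    antidiagonal 𝒮 𝒯 ≤ (antidiagonal 𝒮 𝒯).comap (𝒮.prod 𝒯).adj := by
  intro x hx
  obtain ⟨a, rfl⟩ := mem_antidiagonal.1 hx
  refine mem_antidiagonal.2 ⟨star a, Prod.ext (𝒮.adj_left_unit a).symm ?_⟩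
  exact ((map_neg _ _).trans (congrArg _ (𝒯.adj_left_unit a))).symm

theorem antidiagonal_le_comap_left (b : A) :
    antidiagonal 𝒮 𝒯 ≤ (antidiagonal 𝒮 𝒯).comap ((𝒮.prod 𝒯).left b) := by
  intro x hx
  obtain ⟨a, rfl⟩ := mem_antidiagonal.1 hx
  refine mem_antidiagonal.2 ⟨b * a, Prod.ext (𝒮.left_mul _ _ _) ?_⟩
  exact (congrArg _ (𝒯.left_mul b a _)).trans (map_neg _ _).symm

theorem antidiagonal_le_comap_right (b : A) :
    antidiagonal 𝒮 𝒯 ≤ (antidiagonal 𝒮 𝒯).comap ((𝒮.prod 𝒯).right b) := by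
  intro x hx
  obtain ⟨a, rfl⟩ := mem_antidiagonal.1 hx
  refine mem_antidiagonal.2 ⟨a * b, Prod.ext (𝒮.right_left_unit _ _).symm ?_⟩
  exact (congrArg _ (𝒯.right_left_unit a b).symm).trans (map_neg _ _).symm

/-- Two lifts differ by a matrix over the antidiagonal, that is, by `(M · e, -M · e)` for one matrix
`M` over `A`. Positivity in the quotient thus becomes a pair of conditions coupled only through `M`.
-/
theorem map_mkQ_mem_quotientPreCone_antidiagonal {n : ℕ} {x : Matrix (Fin n) (Fin n) (S × T)} :
    x.map (antidiagonal 𝒮 𝒯).mkQ ∈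
        quotientPreCone (𝒮.prod 𝒯).toOperatorSystem (antidiagonal 𝒮 𝒯) n ↔
      ∃ M : Matrix (Fin n) (Fin n) A, x.map Prod.fst + 𝒮.matrixUnit n M ∈ 𝒮.cone n ∧
        x.map Prod.snd - 𝒯.matrixUnit n M ∈ 𝒯.cone n := by
  constructor
  · rintro ⟨z, hz, hzx⟩
    obtain ⟨M, hM⟩ : ∃ M : Matrix (Fin n) (Fin n) A, ∀ i j,
        (𝒮.left (M i j) 𝒮.unit, -𝒯.left (M i j) 𝒯.unit) = z i j - x i j := by
      choose M hM using fun i j =>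
        mem_antidiagonal.1 ((Submodule.Quotient.eq _).1 (congrFun (congrFun hzx i) j))
      exact ⟨M, hM⟩
    refine ⟨M, ?_, ?_⟩
    · convert hz.1 using 1
      ext i j
      have := congrArg Prod.fst (hM i j)
      simp only [Prod.fst_sub] at this
      simp [this]
    · convert hz.2 using 1
      ext i j
      have := congrArg Prod.snd (hM i j)
      simp only [Prod.snd_sub] at this
      simp [sub_eq_add_neg, this]
  · rintro ⟨M, h₁, h₂⟩
    refine ⟨Matrix.of fun i j => ((x.map Prod.fst + 𝒮.matrixUnit n M) i j,
      (x.map Prod.snd - 𝒯.matrixUnit n M) i j), ⟨h₁, h₂⟩, ?_⟩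
    ext i j
    refine (Submodule.Quotient.eq _).2 (mem_antidiagonal.2 ⟨M i j, ?_⟩)
    ext <;> simp

theorem map_mkQ_mem_quotientCone_antidiagonal {n : ℕ} {x : Matrix (Fin n) (Fin n) (S × T)} :
    x.map (antidiagonal 𝒮 𝒯).mkQ ∈
        quotientCone (𝒮.prod 𝒯).toOperatorSystem (antidiagonal 𝒮 𝒯) n ↔
      ∀ ε : ℝ, 0 < ε → ∃ M : Matrix (Fin n) (Fin n) A,
        (ε : ℂ) • ampl n 𝒮.unit + x.map Prod.fst + 𝒮.matrixUnit n M ∈ 𝒮.cone n ∧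
        (ε : ℂ) • ampl n 𝒯.unit + x.map Prod.snd - 𝒯.matrixUnit n M ∈ 𝒯.cone n := by
  refine forall₂_congr fun ε _ => ?_
  have h1 : (ε : ℂ) • ampl n ((antidiagonal 𝒮 𝒯).mkQ (𝒮.prod 𝒯).unit) +
      x.map (antidiagonal 𝒮 𝒯).mkQ =
      ((ε : ℂ) • ampl n (𝒮.prod 𝒯).unit + x).map (antidiagonal 𝒮 𝒯).mkQ := by
    rw [← ampl_map]
    ext i j
    simp
  have h2 : ((ε : ℂ) • ampl n (𝒮.prod 𝒯).unit + x).map Prod.fst =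
      (ε : ℂ) • ampl n 𝒮.unit + x.map Prod.fst := by
    rw [show 𝒮.unit = LinearMap.fst ℂ S T (𝒮.prod 𝒯).unit from rfl, ← ampl_map]
    rfl
  have h3 : ((ε : ℂ) • ampl n (𝒮.prod 𝒯).unit + x).map Prod.snd =
      (ε : ℂ) • ampl n 𝒯.unit + x.map Prod.snd := by
    rw [show 𝒯.unit = LinearMap.snd ℂ S T (𝒮.prod 𝒯).unit from rfl, ← ampl_map]
    rfl
  rw [h1, map_mkQ_mem_quotientPreCone_antidiagonal, h2, h3]

theorem quotientCone_antidiagonal_proper (h𝒮 : 𝒮.IsFaithful) (h𝒯 : 𝒯.IsFaithful) (n : ℕ)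
    (y : Matrix (Fin n) (Fin n) ((S × T) ⧸ antidiagonal 𝒮 𝒯))
    (hy : y ∈ quotientCone (𝒮.prod 𝒯).toOperatorSystem (antidiagonal 𝒮 𝒯) n)
    (hy' : -y ∈ quotientCone (𝒮.prod 𝒯).toOperatorSystem (antidiagonal 𝒮 𝒯) n) : y = 0 := by
  -- `A` carries no order a priori, and the claim mentions none, so the spectral order is introduced
  -- locally.
  let _ := CStarAlgebra.spectralOrder A
  have _ := CStarAlgebra.spectralOrderedRing A
  obtain ⟨x, rfl⟩ := exists_matrix_map_mkQ _ y
  have hneg : -x.map (antidiagonal 𝒮 𝒯).mkQ = (-x).map (antidiagonal 𝒮 𝒯).mkQ := by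
    ext i j
    simp
  rw [hneg] at hy'
  rw [map_mkQ_mem_quotientCone_antidiagonal] at hy hy'
  set s := x.map Prod.fst with hs
  set t := x.map Prod.snd with ht
  have hs' : (-x).map Prod.fst = -s := rfl
  have ht' : (-x).map Prod.snd = -t := rfl
  rw [hs', ht'] at hy'
  let ε : ℕ → ℝ := fun k => 1 / ((k : ℝ) + 1)
  have hε0 : ∀ k, 0 < ε k := fun k => by positivity
  have hε : Tendsto ε atTop (𝓝 0) := tendsto_one_div_add_atTop_nhds_zero_nat
  have hr : Tendsto (fun k => 3 * ε k) atTop (𝓝 0) := by simpa using hε.const_mul 3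
  choose M hMS hMT using fun k => hy (ε k) (hε0 k)
  choose N hNS hNT using fun k => hy' (ε k) (hε0 k)
  have hc : ∀ k, ((3 * ε k : ℝ) : ℂ) = (ε k : ℂ) + ((ε k + ε k : ℝ) : ℂ) := fun k => by
    push_cast; ring
  -- In the sum of the two conditions over `S` the entries `s` cancel, leaving a condition on `M k +
  -- N k` alone, which faithfulness turns into an inequality over `A`. The conditions over `T` give
  -- the opposite bound.
  have hsum : ∀ k, 0 ≤ ((ε k + ε k : ℝ) : ℂ) • (1 : CStarMatrix (Fin n) (Fin n) A) +
      CStarMatrix.ofMatrix (M k + N k) := fun k => by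
    refine h𝒮.nonneg_of_smul_ampl_add_matrixUnit_mem_cone ?_
    convert 𝒮.cone_add (hMS k) (hNS k) using 1
    rw [Equiv.symm_apply_apply, map_add, Complex.ofReal_add, add_smul]
    abel
  have hsum' : ∀ k, 0 ≤ ((ε k + ε k : ℝ) : ℂ) • (1 : CStarMatrix (Fin n) (Fin n) A) +
      CStarMatrix.ofMatrix (-(M k + N k)) := fun k => by
    refine h𝒯.nonneg_of_smul_ampl_add_matrixUnit_mem_cone ?_
    convert 𝒯.cone_add (hMT k) (hNT k) using 1
    rw [Equiv.symm_apply_apply, map_neg, map_add, Complex.ofReal_add, add_smul]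
    abel
  have hS₁ : ∀ k, ((3 * ε k : ℝ) : ℂ) • ampl n 𝒮.unit + (s + 𝒮.matrixUnit n (M k)) ∈ 𝒮.cone n :=
    fun k => by
      convert 𝒮.smul_ampl_add_mem_cone (hMS k) (add_pos (hε0 k) (hε0 k)).le using 1
      rw [hc, add_smul]
      abel
  -- `-s + N k · e` is bounded below by `-ε k`, and `N k` may be replaced by `-M k` at the price of
  -- `2 ε k`; this use of the bound obtained from `T` explains the constant 3.
  have hS₂ : ∀ k, ((3 * ε k : ℝ) : ℂ) • ampl n 𝒮.unit - (s + 𝒮.matrixUnit n (M k)) ∈ 𝒮.cone n :=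
    fun k => by
      convert 𝒮.cone_add (hNS k)
        (OperatorASystem.smul_ampl_add_matrixUnit_mem_cone (hsum' k)) using 1
      rw [hc, add_smul, Equiv.symm_apply_apply, map_neg, map_add]
      abel
  have hT₁ : ∀ k, ((3 * ε k : ℝ) : ℂ) • ampl n 𝒯.unit + (t + 𝒯.matrixUnit n (-M k)) ∈ 𝒯.cone n :=
    fun k => by
      convert 𝒯.smul_ampl_add_mem_cone (hMT k) (add_pos (hε0 k) (hε0 k)).le using 1
      rw [hc, add_smul, map_neg]
      abel
  have hT₂ : ∀ k, ((3 * ε k : ℝ) : ℂ) • ampl n 𝒯.unit - (t + 𝒯.matrixUnit n (-M k)) ∈ 𝒯.cone n :=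
    fun k => by
      convert 𝒯.cone_add (hNT k)
        (OperatorASystem.smul_ampl_add_matrixUnit_mem_cone (hsum k)) using 1
      rw [hc, add_smul, Equiv.symm_apply_apply, map_add, map_neg]
      abel
  -- Adding the lower bound at `j` to the upper bound at `k` cancels `s` and compares `M j` with `M
  -- k`.
  obtain ⟨L, hL⟩ := CStarAlgebra.exists_limit_of_nonneg_smul_one_add_sub
    (f := fun k => CStarMatrix.ofMatrix (M k)) hr (fun k => by have := hε0 k; positivity)
    (fun j k => by
      refine h𝒮.nonneg_of_smul_ampl_add_matrixUnit_mem_cone ?_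
      convert 𝒮.cone_add (hS₁ j) (hS₂ k) using 1
      rw [CStarMatrix.of_sub_of, Equiv.symm_apply_apply, map_sub, Complex.ofReal_add, add_smul]
      abel)
  have hs0 : s + 𝒮.matrixUnit n (CStarMatrix.ofMatrix.symm L) = 0 :=
    OperatorASystem.add_matrixUnit_eq_zero_of_tendsto hr hS₁ hS₂
      (fun k => (hL k).1) (fun k => (hL k).2)
  have ht0 : t + 𝒯.matrixUnit n (CStarMatrix.ofMatrix.symm (-L)) = 0 :=
    OperatorASystem.add_matrixUnit_eq_zero_of_tendsto
      (M := fun k => CStarMatrix.ofMatrix (-M k)) hr hT₁ hT₂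
      (fun k => by
        have := (hL k).2
        rwa [← CStarMatrix.neg_of, neg_sub_neg])
      (fun k => by
        have := (hL k).1
        rwa [← CStarMatrix.neg_of, neg_sub_neg])
  ext i j
  refine (Submodule.Quotient.mk_eq_zero _).2 (mem_antidiagonal.2 ⟨-L i j, ?_⟩)
  have h1 := congrFun (congrFun hs0 i) j
  have h2 := congrFun (congrFun ht0 i) j
  refine Prod.ext ?_ ?_
  · rw [map_neg, LinearMap.neg_apply]
    exact neg_eq_of_add_eq_zero_left h1
  · exact neg_eq_of_add_eq_zero_left h2

theorem isKernel_antidiagonal (h𝒮 : 𝒮.IsFaithful) (h𝒯 : 𝒯.IsFaithful) :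
    IsKernel (𝒮.prod 𝒯).toOperatorSystem (antidiagonal 𝒮 𝒯) :=
  isKernel_of_proper _ _ antidiagonal_le_comap_adj (quotientCone_antidiagonal_proper h𝒮 h𝒯)

end antidiagonal

/-! ### The bimodule structure on the quotient. -/

namespace OperatorASystem

variable {A : Type a} [CStarAlgebra A]
variable {V : Type u} [AddCommGroup V] [Module ℂ V]
variable {W : Type v} [AddCommGroup W] [Module ℂ W]

/-- The matrix `B · x · B*`. -/
noncomputable def moduleConj (𝒱 : OperatorASystem A V) {m n : ℕ} (B : Matrix (Fin m) (Fin n) A)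
    (x : Matrix (Fin n) (Fin n) V) : Matrix (Fin m) (Fin m) V :=
  Matrix.of fun i j => ∑ k, ∑ l, 𝒱.right (star (B j l)) (𝒱.left (B i k) (x k l))

theorem moduleConj_add (𝒱 : OperatorASystem A V) {m n : ℕ} (B : Matrix (Fin m) (Fin n) A)
    (x y : Matrix (Fin n) (Fin n) V) :
    𝒱.moduleConj B (x + y) = 𝒱.moduleConj B x + 𝒱.moduleConj B y := by
  ext i j
  simp [moduleConj, Finset.sum_add_distrib]

theorem moduleConj_smul (𝒱 : OperatorASystem A V) {m n : ℕ} (B : Matrix (Fin m) (Fin n) A)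
    (c : ℂ) (x : Matrix (Fin n) (Fin n) V) :
    𝒱.moduleConj B (c • x) = c • 𝒱.moduleConj B x := by
  ext i j
  simp [moduleConj, Finset.smul_sum]

theorem moduleConj_mem_cone (𝒱 : OperatorASystem A V) {m n : ℕ} (B : Matrix (Fin m) (Fin n) A)
    {x : Matrix (Fin n) (Fin n) V} (hx : x ∈ 𝒱.cone n) : 𝒱.moduleConj B x ∈ 𝒱.cone m :=
  𝒱.module_conj B hx

/-- The quotient of an operator `A`-system by a kernel that is a sub-bimodule. -/
noncomputable def quotient (𝒱 : OperatorASystem A V) (J : Submodule ℂ V)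
    (hJ : IsKernel 𝒱.toOperatorSystem J) (hleft : ∀ a, J ≤ J.comap (𝒱.left a))
    (hright : ∀ a, J ≤ J.comap (𝒱.right a)) : OperatorASystem A (V ⧸ J) where
  toOperatorSystem := 𝒱.toOperatorSystem.quotient J hJ
  left :=
    { toFun := fun a => J.mapQ J (𝒱.left a) (hleft a)
      map_add' := fun a b => by ext; simp
      map_smul' := fun c a => by ext; simp }
  right :=
    { toFun := fun a => J.mapQ J (𝒱.right a) (hright a)
      map_add' := fun a b => by ext; simp
      map_smul' := fun c a => by ext; simp }
  left_right a b y := by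
    obtain ⟨x, rfl⟩ := J.mkQ_surjective y
    simp [𝒱.left_right]
  left_mul a b y := by
    obtain ⟨x, rfl⟩ := J.mkQ_surjective y
    simp [𝒱.left_mul]
  right_mul a b y := by
    obtain ⟨x, rfl⟩ := J.mkQ_surjective y
    simp [𝒱.right_mul]
  one_left y := by
    obtain ⟨x, rfl⟩ := J.mkQ_surjective y
    simp [𝒱.one_left]
  one_right y := by
    obtain ⟨x, rfl⟩ := J.mkQ_surjective y
    simp [𝒱.one_right]
  adj_left a y := by
    obtain ⟨x, rfl⟩ := J.mkQ_surjective y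
    exact congrArg J.mkQ (𝒱.adj_left a x)
  left_unit a := congrArg J.mkQ (𝒱.left_unit a)
  module_conj {m n} B y hy ε hε := by
    obtain ⟨x, rfl⟩ := exists_matrix_map_mkQ J y
    -- As for scalar matrices, `r e_m` dominates `B · e_n · B*`, which dictates the error `ε / r` in
    -- the choice of the lift.
    obtain ⟨r, hr, h0⟩ := 𝒱.order_unit
      (𝒱.cone_hermitian (𝒱.moduleConj_mem_cone B (𝒱.ampl_mem_cone n)))
    obtain ⟨z, hz, hzx⟩ := hy (ε / r) (by positivity)
    refine ⟨_, 𝒱.cone_add (𝒱.moduleConj_mem_cone B hz)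
      (𝒱.cone_smul (r := ε / r) (by positivity) h0), ?_⟩
    have hmap : ∀ z : Matrix (Fin n) (Fin n) V, (𝒱.moduleConj B z).map J.mkQ =
        Matrix.of (fun i j => ∑ k, ∑ l, J.mapQ J (𝒱.right (star (B j l))) (hright _)
          (J.mapQ J (𝒱.left (B i k)) (hleft _) (z.map J.mkQ k l))) := by
      intro z
      ext i j
      simp [moduleConj]
    have hz' : (𝒱.moduleConj B z).map J.mkQ = (𝒱.moduleConj B
        (((ε / r : ℝ) : ℂ) • ampl n 𝒱.unit + x)).map J.mkQ := by
      rw [hmap, hmap, hzx, ← ampl_map]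
      congr! 9 with i j k _ l _
    rw [Matrix.map_add _ (map_add J.mkQ), hz', moduleConj_add, moduleConj_smul,
      ← Matrix.map_add _ (map_add J.mkQ), smul_sub, smul_smul, ← Complex.ofReal_mul,
      div_mul_cancel₀ _ hr.ne']
    rw [show ∀ p q r : Matrix (Fin m) (Fin m) V, p + q + (r - p) = r + q by intros; abel,
      Matrix.map_add _ (map_add J.mkQ), hmap x, ← ampl_map]
    congr 1

end OperatorASystem

/-! ### Composition of bimodule maps and of u.c.p. maps. -/

namespace IsBimoduleMap

variable {A : Type a} [CStarAlgebra A]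
variable {V : Type u} [AddCommGroup V] [Module ℂ V]
variable {W : Type v} [AddCommGroup W] [Module ℂ W]
variable {X : Type w} [AddCommGroup X] [Module ℂ X]
variable {𝒱 : OperatorASystem A V} {𝒲 : OperatorASystem A W} {𝒳 : OperatorASystem A X}

theorem map_left {φ : V →ₗ[ℂ] W} (h : IsBimoduleMap 𝒱 𝒲 φ) (a : A) (x : V) :
    φ (𝒱.left a x) = 𝒲.left a (φ x) := by
  simpa [𝒱.one_right, 𝒲.one_right] using h a 1 x

theorem comp {φ : V →ₗ[ℂ] W} {ψ : W →ₗ[ℂ] X} (hψ : IsBimoduleMap 𝒲 𝒳 ψ)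
    (hφ : IsBimoduleMap 𝒱 𝒲 φ) : IsBimoduleMap 𝒱 𝒳 (ψ ∘ₗ φ) := fun a b x => by
  rw [LinearMap.comp_apply, hφ, hψ, LinearMap.comp_apply]

theorem id (𝒱 : OperatorASystem A V) : IsBimoduleMap 𝒱 𝒱 LinearMap.id := fun _ _ _ => rfl

end IsBimoduleMap

namespace IsUCP

variable {V : Type u} [AddCommGroup V] [Module ℂ V]
variable {W : Type v} [AddCommGroup W] [Module ℂ W]
variable {X : Type w} [AddCommGroup X] [Module ℂ X]
variable {𝒱 : OperatorSystem V} {𝒲 : OperatorSystem W} {𝒳 : OperatorSystem X}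

theorem comp {φ : V →ₗ[ℂ] W} {ψ : W →ₗ[ℂ] X} (hψ : IsUCP 𝒲 𝒳 ψ) (hφ : IsUCP 𝒱 𝒲 φ) :
    IsUCP 𝒱 𝒳 (ψ ∘ₗ φ) where
  unital := by rw [LinearMap.comp_apply, hφ.unital, hψ.unital]
  cp n x hx := hψ.cp n _ (hφ.cp n x hx)

theorem id (𝒱 : OperatorSystem V) : IsUCP 𝒱 𝒱 LinearMap.id := ⟨rfl, fun _ _ hx => hx⟩

theorem of_isCOE {φ : V →ₗ[ℂ] W} (hu : φ 𝒱.unit = 𝒲.unit) (h : IsCOE 𝒱 𝒲 φ) : IsUCP 𝒱 𝒲 φ :=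
  ⟨hu, fun n x hx => (h.2 n x).1 hx⟩

end IsUCP

/-! ### Transport of structure, used to change universes. -/

section transport

variable {A : Type a} [CStarAlgebra A]
variable {V : Type u} [AddCommGroup V] [Module ℂ V]
variable {W : Type v} [AddCommGroup W] [Module ℂ W]

/-- Transport of an operator `A`-system structure along a linear equivalence. -/
noncomputable def OperatorASystem.transport (𝒱 : OperatorASystem A V) (e : V ≃ₗ[ℂ] W) :
    OperatorASystem A W where
  adj := e.toLinearMap ∘ₛₗ 𝒱.adj ∘ₛₗ e.symm.toLinearMap
  adj_adj x := by simp [𝒱.adj_adj]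
  cone n := {x | x.map e.symm ∈ 𝒱.cone n}
  cone_nonempty n := by
    obtain ⟨x, hx⟩ := 𝒱.cone_nonempty n
    exact ⟨x.map e, by simpa [Matrix.map_map, Function.comp_def] using hx⟩
  cone_hermitian {n x} hx i j := by
    simpa using congrArg e (𝒱.cone_hermitian hx i j)
  cone_add {n x y} hx hy := by
    have := 𝒱.cone_add hx hy
    rwa [← Matrix.map_add _ (map_add e.symm)] at this
  cone_smul {n r x} hr hx := by
    have := 𝒱.cone_smul hr hx
    rwa [← Matrix.map_smul _ _ (map_smul e.symm _)] at this
  cone_proper {n x} hx hy := by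
    have h : (-x).map e.symm = -x.map e.symm := by ext i j; simp
    have := 𝒱.cone_proper hx (h ▸ hy)
    ext i j
    simpa using congrFun (congrFun this i) j
  cone_conj {m n} X x hx := by
    have := 𝒱.cone_conj X hx
    rwa [← LinearEquiv.coe_coe, ← scalarConj_map] at this
  unit := e 𝒱.unit
  adj_unit := by simp [𝒱.adj_unit]
  order_unit {n x} hx := by
    obtain ⟨r, hr, h⟩ := 𝒱.order_unit (n := n) (x := x.map e.symm)
      (fun i j => e.injective (by simpa using hx i j))
    refine ⟨r, hr, ?_⟩
    rw [Set.mem_ofPred_eq]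
    convert h using 1
    rw [← LinearEquiv.coe_coe e, ← ampl_map]
    ext i j
    simp [-Complex.coe_smul]
  archimedean {n x} hx h := by
    refine 𝒱.archimedean (n := n) (x := x.map e.symm)
      (fun i j => e.injective (by simpa using hx i j)) fun r hr => ?_
    have h := h r hr
    rw [Set.mem_ofPred_eq] at h
    convert h using 1
    rw [← LinearEquiv.coe_coe e, ← ampl_map]
    ext i j
    simp [-Complex.coe_smul]
  left :=
    { toFun := fun a => e.toLinearMap ∘ₗ 𝒱.left a ∘ₗ e.symm.toLinearMap
      map_add' := fun a b => by ext; simp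
      map_smul' := fun c a => by ext; simp }
  right :=
    { toFun := fun a => e.toLinearMap ∘ₗ 𝒱.right a ∘ₗ e.symm.toLinearMap
      map_add' := fun a b => by ext; simp
      map_smul' := fun c a => by ext; simp }
  left_right a b x := by simp [𝒱.left_right]
  left_mul a b x := by simp [𝒱.left_mul]
  right_mul a b x := by simp [𝒱.right_mul]
  one_left x := by simp [𝒱.one_left]
  one_right x := by simp [𝒱.one_right]
  adj_left a x := by simp [𝒱.adj_left]
  left_unit a := by simp [𝒱.left_unit]
  module_conj {m n} B x hx := by
    rw [Set.mem_ofPred_eq]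
    convert 𝒱.module_conj B hx using 1
    ext i j
    simp

variable (𝒱 : OperatorASystem A V) (e : V ≃ₗ[ℂ] W)

theorem OperatorASystem.isUCP_transport :
    IsUCP 𝒱.toOperatorSystem (𝒱.transport e).toOperatorSystem e.toLinearMap :=
  ⟨rfl, fun n x hx => show _ ∈ 𝒱.cone n by simpa [Matrix.map_map, Function.comp_def] using hx⟩

theorem OperatorASystem.isUCP_transport_symm :
    IsUCP (𝒱.transport e).toOperatorSystem 𝒱.toOperatorSystem e.symm.toLinearMap :=
  ⟨e.symm_apply_apply _, fun _ _ hx => hx⟩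

theorem OperatorASystem.isBimoduleMap_transport :
    IsBimoduleMap 𝒱 (𝒱.transport e) e.toLinearMap := fun a b x => by
  simp [transport]

theorem OperatorASystem.isBimoduleMap_transport_symm :
    IsBimoduleMap (𝒱.transport e) 𝒱 e.symm.toLinearMap := fun a b x => by
  simp [transport]

end transport

/-! ### Universe change and uniqueness of coproducts. -/

namespace IsCoproduct

variable {A : Type a} [CStarAlgebra A]
variable {S : Type u} [AddCommGroup S] [Module ℂ S] {T : Type v} [AddCommGroup T] [Module ℂ T]
variable {𝒮 : OperatorASystem A S} {𝒯 : OperatorASystem A T}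

universe w' q

/-- The universal property in a larger universe implies the one in a smaller universe. -/
theorem of_max {P : Type p} [AddCommGroup P] [Module ℂ P] {𝒢 : OperatorASystem A P}
    {φ₁ : S →ₗ[ℂ] P} {φ₂ : T →ₗ[ℂ] P}
    (h : IsCoproduct.{u, v, max w w', p, a} 𝒮 𝒯 𝒢 φ₁ φ₂) :
    IsCoproduct.{u, v, w, p, a} 𝒮 𝒯 𝒢 φ₁ φ₂ where
  faithful := h.faithful
  unital₁ := h.unital₁
  unital₂ := h.unital₂
  coe₁ := h.coe₁
  coe₂ := h.coe₂
  bimodule₁ := h.bimodule₁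
  bimodule₂ := h.bimodule₂
  universal R _ _ ℛ ψ₁ ψ₂ hψ₁ hψ₁' hψ₂ hψ₂' := by
    let e : R ≃ₗ[ℂ] ULift.{w'} R := ULift.moduleEquiv.symm
    have hu := ℛ.isUCP_transport e
    have hb := ℛ.isBimoduleMap_transport e
    obtain ⟨Ψ, ⟨⟨hΨ, hΨ'⟩, h₁, h₂⟩, huniq⟩ := h.universal (ULift.{w'} R) (ℛ.transport e)
      (e.toLinearMap ∘ₗ ψ₁) (e.toLinearMap ∘ₗ ψ₂) (hu.comp hψ₁) (hb.comp hψ₁')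
      (hu.comp hψ₂) (hb.comp hψ₂')
    refine ⟨e.symm.toLinearMap ∘ₗ Ψ, ⟨⟨(ℛ.isUCP_transport_symm e).comp hΨ,
      (ℛ.isBimoduleMap_transport_symm e).comp hΨ'⟩, ?_, ?_⟩, ?_⟩
    · rw [LinearMap.comp_assoc, h₁]
      ext x
      simp
    · rw [LinearMap.comp_assoc, h₂]
      ext x
      simp
    · rintro Ψ' ⟨⟨h3, h4⟩, h5, h6⟩
      have := huniq (e.toLinearMap ∘ₗ Ψ') ⟨⟨hu.comp h3, hb.comp h4⟩,
        by rw [LinearMap.comp_assoc, h5], by rw [LinearMap.comp_assoc, h6]⟩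
      rw [← this]
      ext x
      simp

/-- Two coproducts are isomorphic. -/
theorem exists_equiv {P : Type p} [AddCommGroup P] [Module ℂ P] {𝒢 : OperatorASystem A P}
    {φ₁ : S →ₗ[ℂ] P} {φ₂ : T →ₗ[ℂ] P}
    {Q : Type q} [AddCommGroup Q] [Module ℂ Q] {𝒬 : OperatorASystem A Q}
    {ι₁ : S →ₗ[ℂ] Q} {ι₂ : T →ₗ[ℂ] Q}
    (hQQ : IsCoproduct.{u, v, q, q, a} 𝒮 𝒯 𝒬 ι₁ ι₂)
    (hQP : IsCoproduct.{u, v, p, q, a} 𝒮 𝒯 𝒬 ι₁ ι₂)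
    (hPQ : IsCoproduct.{u, v, q, p, a} 𝒮 𝒯 𝒢 φ₁ φ₂)
    (hPP : IsCoproduct.{u, v, p, p, a} 𝒮 𝒯 𝒢 φ₁ φ₂) :
    ∃ Θ : Q ≃ₗ[ℂ] P, Θ 𝒬.unit = 𝒢.unit ∧
      IsCOI 𝒬.toOperatorSystem 𝒢.toOperatorSystem Θ ∧ IsBimoduleMap 𝒬 𝒢 Θ ∧
      (∀ s, Θ (ι₁ s) = φ₁ s) ∧ ∀ t, Θ (ι₂ t) = φ₂ t := by
  have hι₁ := IsUCP.of_isCOE hQP.unital₁ hQP.coe₁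
  have hι₂ := IsUCP.of_isCOE hQP.unital₂ hQP.coe₂
  have hφ₁ := IsUCP.of_isCOE hPQ.unital₁ hPQ.coe₁
  have hφ₂ := IsUCP.of_isCOE hPQ.unital₂ hPQ.coe₂
  obtain ⟨F, ⟨⟨hF, hF'⟩, hF₁, hF₂⟩, -⟩ :=
    hQP.universal P 𝒢 φ₁ φ₂ hφ₁ hPQ.bimodule₁ hφ₂ hPQ.bimodule₂
  obtain ⟨G, ⟨⟨hG, hG'⟩, hG₁, hG₂⟩, -⟩ :=
    hPQ.universal Q 𝒬 ι₁ ι₂ hι₁ hQP.bimodule₁ hι₂ hQP.bimodule₂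
  have hFG : F ∘ₗ G = LinearMap.id :=
    (hPP.universal P 𝒢 φ₁ φ₂ hφ₁ hPQ.bimodule₁ hφ₂ hPQ.bimodule₂).unique
      ⟨⟨hF.comp hG, hF'.comp hG'⟩, by rw [LinearMap.comp_assoc, hG₁, hF₁],
        by rw [LinearMap.comp_assoc, hG₂, hF₂]⟩
      ⟨⟨IsUCP.id _, IsBimoduleMap.id _⟩, rfl, rfl⟩
  have hGF : G ∘ₗ F = LinearMap.id :=
    (hQQ.universal Q 𝒬 ι₁ ι₂ hι₁ hQP.bimodule₁ hι₂ hQP.bimodule₂).unique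
      ⟨⟨hG.comp hF, hG'.comp hF'⟩, by rw [LinearMap.comp_assoc, hF₁, hG₁],
        by rw [LinearMap.comp_assoc, hF₂, hG₂]⟩
      ⟨⟨IsUCP.id _, IsBimoduleMap.id _⟩, rfl, rfl⟩
  exact ⟨LinearEquiv.ofLinearMap F G hFG hGF, hF.unital, ⟨hF.cp, hG.cp⟩, hF',
    LinearMap.congr_fun hF₁, LinearMap.congr_fun hF₂⟩

end IsCoproduct

/-! ### The quotient is a coproduct. -/

section coproduct

variable {A : Type a} [CStarAlgebra A]
variable {S : Type u} [AddCommGroup S] [Module ℂ S] {T : Type v} [AddCommGroup T] [Module ℂ T]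
variable {𝒮 : OperatorASystem A S} {𝒯 : OperatorASystem A T}

/-- The operator `A`-system `(S ⊕ T) / J` for `J = {a ⊕ (-a) : a ∈ A}`. -/
noncomputable def OperatorASystem.amalgam (h𝒮 : 𝒮.IsFaithful) (h𝒯 : 𝒯.IsFaithful) :
    OperatorASystem A ((S × T) ⧸ antidiagonal 𝒮 𝒯) :=
  (𝒮.prod 𝒯).quotient (antidiagonal 𝒮 𝒯) (isKernel_antidiagonal h𝒮 h𝒯)
    antidiagonal_le_comap_left antidiagonal_le_comap_right

theorem isBimoduleMap_mkQ_amalgam (h𝒮 : 𝒮.IsFaithful) (h𝒯 : 𝒯.IsFaithful) :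
    IsBimoduleMap (𝒮.prod 𝒯) (OperatorASystem.amalgam h𝒮 h𝒯) (antidiagonal 𝒮 𝒯).mkQ :=
  fun _ _ _ => rfl

theorem isUCP_mkQ_amalgam (h𝒮 : 𝒮.IsFaithful) (h𝒯 : 𝒯.IsFaithful) :
    IsUCP (𝒮.prod 𝒯).toOperatorSystem (OperatorASystem.amalgam h𝒮 h𝒯).toOperatorSystem
      (antidiagonal 𝒮 𝒯).mkQ :=
  ⟨rfl, fun _ _ hx => map_mkQ_mem_quotientCone _ hx⟩

theorem two_smul_mkQ_inl_unit :
    (2 : ℂ) • (antidiagonal 𝒮 𝒯).mkQ (𝒮.unit, 0) = (antidiagonal 𝒮 𝒯).mkQ (𝒮.prod 𝒯).unit := by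
  rw [← map_smul]
  -- The difference `2 (e, 0) - (e, e)` is `(e, -e)`, the antidiagonal element of `1`.
  refine (Submodule.Quotient.eq _).2 (mem_antidiagonal.2 ⟨1, ?_⟩)
  rw [𝒮.one_left, 𝒯.one_left, two_smul]
  ext <;> simp [OperatorASystem.prod, OperatorSystem.prod]

theorem two_smul_mkQ_inr_unit :
    (2 : ℂ) • (antidiagonal 𝒮 𝒯).mkQ (0, 𝒯.unit) = (antidiagonal 𝒮 𝒯).mkQ (𝒮.prod 𝒯).unit := by
  rw [← map_smul]
  refine (Submodule.Quotient.eq _).2 (mem_antidiagonal.2 ⟨-1, ?_⟩)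
  rw [map_neg, map_neg, LinearMap.neg_apply, LinearMap.neg_apply, 𝒮.one_left, 𝒯.one_left, two_smul]
  ext <;> simp [OperatorASystem.prod, OperatorSystem.prod]

/-- If `a` kills the unit, then `(a · e, a · e)` is antidiagonal, and faithfulness of both systems
forces `a = -a`. -/
theorem OperatorASystem.IsFaithful.amalgam (h𝒮 : 𝒮.IsFaithful) (h𝒯 : 𝒯.IsFaithful) :
    (OperatorASystem.amalgam h𝒮 h𝒯).IsFaithful := by
  intro a ha h0
  have h1 : (𝒮.left a 𝒮.unit, 𝒯.left a 𝒯.unit) ∈ antidiagonal 𝒮 𝒯 :=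
    (Submodule.Quotient.mk_eq_zero _).1 h0
  obtain ⟨b, hb⟩ := mem_antidiagonal.1 h1
  have hba : b = a := h𝒮.left_unit_injective (congrArg Prod.fst hb)
  have h2 : 𝒯.left (-b) 𝒯.unit = 𝒯.left a 𝒯.unit := by
    rw [map_neg, LinearMap.neg_apply]
    exact congrArg Prod.snd hb
  rw [hba] at h2
  have hab : -a = a := h𝒯.left_unit_injective h2
  refine ha ?_
  have h3 : (2 : ℂ) • a = 0 := by
    rw [two_smul]
    nth_rw 1 [← hab]
    exact neg_add_cancel a
  exact (smul_eq_zero.1 h3).resolve_left two_ne_zero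

theorem isBimoduleMap_inl : IsBimoduleMap 𝒮 (𝒮.prod 𝒯) (LinearMap.inl ℂ S T) := fun b c x => by
  ext <;> simp [OperatorASystem.prod]

theorem isBimoduleMap_inr : IsBimoduleMap 𝒯 (𝒮.prod 𝒯) (LinearMap.inr ℂ S T) := fun b c x => by
  ext <;> simp [OperatorASystem.prod]

theorem IsBimoduleMap.smul {V : Type*} [AddCommGroup V] [Module ℂ V] {W : Type*}
    [AddCommGroup W] [Module ℂ W] {𝒱 : OperatorASystem A V} {𝒲 : OperatorASystem A W}
    {φ : V →ₗ[ℂ] W} (h : IsBimoduleMap 𝒱 𝒲 φ) (c : ℂ) : IsBimoduleMap 𝒱 𝒲 (c • φ) :=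
  fun a b x => by simp [h a b x]

theorem OperatorSystem.mem_cone_of_forall_add_two_smul {V : Type*} [AddCommGroup V] [Module ℂ V]
    {𝒱 : OperatorSystem V} {n : ℕ} {x : Matrix (Fin n) (Fin n) V}
    (h : ∀ ε : ℝ, 0 < ε → ((ε + ε : ℝ) : ℂ) • ampl n 𝒱.unit + (2 : ℂ) • x ∈ 𝒱.cone n) :
    x ∈ 𝒱.cone n := by
  refine 𝒱.mem_cone_of_forall_smul_ampl_add (c := 1) one_pos fun r hr => ?_
  convert 𝒱.cone_smul (r := 1 / 2) (by norm_num) (h r hr) using 1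
  rw [smul_add, smul_smul, smul_smul]
  have h1 : ((1 / 2 : ℝ) : ℂ) * 2 = 1 := by push_cast; norm_num
  have h2 : ((1 / 2 : ℝ) : ℂ) * ((r + r : ℝ) : ℂ) = ((1 * r : ℝ) : ℂ) := by push_cast; ring
  rw [h1, h2, one_smul]

/-- For reflection of positivity, the condition in `T` reads `ε - M · e ≥ 0`. Faithfulness of `T`
moves it to `A`, and from there to `S`, where it cancels the `M · e` in `ε + 2x + M · e ≥ 0`. -/
theorem isCOE_two_smul_mkQ_inl (h𝒮 : 𝒮.IsFaithful) (h𝒯 : 𝒯.IsFaithful) :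
    IsCOE 𝒮.toOperatorSystem (OperatorASystem.amalgam h𝒮 h𝒯).toOperatorSystem
      ((2 : ℂ) • (antidiagonal 𝒮 𝒯).mkQ ∘ₗ LinearMap.inl ℂ S T) := by
  let _ := CStarAlgebra.spectralOrder A
  have _ := CStarAlgebra.spectralOrderedRing A
  refine ⟨(injective_iff_map_eq_zero _).2 fun s hs => ?_, fun n x => ?_⟩
  · have h1 : (s, (0 : T)) ∈ antidiagonal 𝒮 𝒯 :=
      (Submodule.Quotient.mk_eq_zero _).1
        ((smul_eq_zero.1 (show (2 : ℂ) • (antidiagonal 𝒮 𝒯).mkQ (s, (0 : T)) = 0 from hs)).resolve_left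
          two_ne_zero)
    obtain ⟨a, ha⟩ := mem_antidiagonal.1 h1
    -- The zero second coordinate forces `a = 0` through faithfulness of `T`, and then `s = a · e_S
    -- = 0`.
    have h2 : a = 0 := h𝒯.left_unit_injective (by
      simpa using congrArg Prod.snd ha)
    have h3 := congrArg Prod.fst ha
    simpa [h2] using h3.symm
  · have hx : x.map ((2 : ℂ) • (antidiagonal 𝒮 𝒯).mkQ ∘ₗ LinearMap.inl ℂ S T) =
        (Matrix.of fun i j => ((2 : ℂ) • x i j, (0 : T))).map (antidiagonal 𝒮 𝒯).mkQ := by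
      ext i j
      simp only [Matrix.map_apply, LinearMap.smul_apply, LinearMap.comp_apply, LinearMap.inl_apply,
        Matrix.of_apply, ← map_smul, Prod.smul_mk, smul_zero]
    have hfst : (Matrix.of fun i j => ((2 : ℂ) • x i j, (0 : T))).map Prod.fst = (2 : ℂ) • x := rfl
    have hsnd : (Matrix.of fun i j => ((2 : ℂ) • x i j, (0 : T))).map Prod.snd = 0 := rfl
    rw [hx]
    constructor
    · intro h
      refine map_mkQ_mem_quotientCone _ ⟨?_, ?_⟩
      · rw [hfst]
        simpa using 𝒮.cone_smul (r := 2) two_pos.le h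
      · rw [hsnd]
        exact 𝒯.zero_mem_cone n
    · intro h
      refine OperatorSystem.mem_cone_of_forall_add_two_smul fun ε hε => ?_
      obtain ⟨M, h₁, h₂⟩ := map_mkQ_mem_quotientCone_antidiagonal.1 h ε hε
      rw [hfst] at h₁
      rw [hsnd, add_zero, sub_eq_add_neg, ← map_neg] at h₂
      have h₃ := h𝒯.nonneg_of_smul_ampl_add_matrixUnit_mem_cone
        (M := CStarMatrix.ofMatrix (-M)) h₂
      convert 𝒮.cone_add h₁ (OperatorASystem.smul_ampl_add_matrixUnit_mem_cone h₃) using 1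
      rw [Equiv.symm_apply_apply, map_neg, Complex.ofReal_add, add_smul]
      abel

theorem isCOE_two_smul_mkQ_inr (h𝒮 : 𝒮.IsFaithful) (h𝒯 : 𝒯.IsFaithful) :
    IsCOE 𝒯.toOperatorSystem (OperatorASystem.amalgam h𝒮 h𝒯).toOperatorSystem
      ((2 : ℂ) • (antidiagonal 𝒮 𝒯).mkQ ∘ₗ LinearMap.inr ℂ S T) := by
  let _ := CStarAlgebra.spectralOrder A
  have _ := CStarAlgebra.spectralOrderedRing A
  refine ⟨(injective_iff_map_eq_zero _).2 fun t ht => ?_, fun n x => ?_⟩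
  · have h1 : ((0 : S), t) ∈ antidiagonal 𝒮 𝒯 :=
      (Submodule.Quotient.mk_eq_zero _).1
        ((smul_eq_zero.1 (show (2 : ℂ) • (antidiagonal 𝒮 𝒯).mkQ ((0 : S), t) = 0 from ht)).resolve_left
          two_ne_zero)
    obtain ⟨a, ha⟩ := mem_antidiagonal.1 h1
    have h2 : a = 0 := h𝒮.left_unit_injective (by
      simpa using congrArg Prod.fst ha)
    have h3 := congrArg Prod.snd ha
    simpa [h2] using h3.symm
  · have hx : x.map ((2 : ℂ) • (antidiagonal 𝒮 𝒯).mkQ ∘ₗ LinearMap.inr ℂ S T) =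
        (Matrix.of fun i j => ((0 : S), (2 : ℂ) • x i j)).map (antidiagonal 𝒮 𝒯).mkQ := by
      ext i j
      simp only [Matrix.map_apply, LinearMap.smul_apply, LinearMap.comp_apply, LinearMap.inr_apply,
        Matrix.of_apply, ← map_smul, Prod.smul_mk, smul_zero]
    have hfst : (Matrix.of fun i j => ((0 : S), (2 : ℂ) • x i j)).map Prod.fst = 0 := rfl
    have hsnd : (Matrix.of fun i j => ((0 : S), (2 : ℂ) • x i j)).map Prod.snd = (2 : ℂ) • x := rfl
    rw [hx]
    constructor
    · intro h
      refine map_mkQ_mem_quotientCone _ ⟨?_, ?_⟩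
      · rw [hfst]
        exact 𝒮.zero_mem_cone n
      · rw [hsnd]
        simpa using 𝒯.cone_smul (r := 2) two_pos.le h
    · intro h
      refine OperatorSystem.mem_cone_of_forall_add_two_smul fun ε hε => ?_
      obtain ⟨M, h₁, h₂⟩ := map_mkQ_mem_quotientCone_antidiagonal.1 h ε hε
      rw [hfst, add_zero] at h₁
      rw [hsnd] at h₂
      have h₃ := h𝒮.nonneg_of_smul_ampl_add_matrixUnit_mem_cone
        (M := CStarMatrix.ofMatrix M) h₁
      convert 𝒯.cone_add h₂ (OperatorASystem.smul_ampl_add_matrixUnit_mem_cone h₃) using 1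
      rw [Equiv.symm_apply_apply, Complex.ofReal_add, add_smul]
      abel

section lift

variable {R : Type w} [AddCommGroup R] [Module ℂ R] {ℛ : OperatorASystem A R}
variable {ψ₁ : S →ₗ[ℂ] R} {ψ₂ : T →ₗ[ℂ] R}

/-- Unital bimodule maps both send `a · e` to `a · e` in `R`, so the contributions of the two
summands cancel. -/
theorem antidiagonal_le_ker_half_coprod
    (h₁ : IsUCP 𝒮.toOperatorSystem ℛ.toOperatorSystem ψ₁) (h₁' : IsBimoduleMap 𝒮 ℛ ψ₁)
    (h₂ : IsUCP 𝒯.toOperatorSystem ℛ.toOperatorSystem ψ₂) (h₂' : IsBimoduleMap 𝒯 ℛ ψ₂) :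
    antidiagonal 𝒮 𝒯 ≤ LinearMap.ker ((1 / 2 : ℂ) • ψ₁.coprod ψ₂) := by
  intro x hx
  obtain ⟨a, rfl⟩ := mem_antidiagonal.1 hx
  simp [h₁'.map_left, h₂'.map_left, h₁.unital, h₂.unital]

theorem isUCP_liftQ_half_coprod (h𝒮 : 𝒮.IsFaithful) (h𝒯 : 𝒯.IsFaithful)
    (h₁ : IsUCP 𝒮.toOperatorSystem ℛ.toOperatorSystem ψ₁)
    (h₂ : IsUCP 𝒯.toOperatorSystem ℛ.toOperatorSystem ψ₂)
    (hker : antidiagonal 𝒮 𝒯 ≤ LinearMap.ker ((1 / 2 : ℂ) • ψ₁.coprod ψ₂)) :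
    IsUCP (OperatorASystem.amalgam h𝒮 h𝒯).toOperatorSystem ℛ.toOperatorSystem
      ((antidiagonal 𝒮 𝒯).liftQ _ hker) := by
  have hunit : (antidiagonal 𝒮 𝒯).liftQ _ hker ((antidiagonal 𝒮 𝒯).mkQ (𝒮.prod 𝒯).unit) =
      ℛ.unit := by
    have : (1 / 2 : ℂ) • (ψ₁ 𝒮.unit + ψ₂ 𝒯.unit) = ℛ.unit := by
      rw [h₁.unital, h₂.unital, ← two_smul ℂ, smul_smul]
      norm_num
    exact this
  refine ⟨hunit, fun n y hy => ?_⟩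
  -- An element of the quotient cone has a positive lift only after adding `r` times the unit; the
  -- Archimedean property of `R` removes this perturbation.
  refine OperatorSystem.mem_cone_of_forall_smul_ampl_add one_pos fun r hr => ?_
  obtain ⟨x, hx, hxy⟩ := hy r hr
  convert ℛ.cone_smul (r := 1 / 2) (by norm_num)
    (ℛ.cone_add (h₁.cp n _ hx.1) (h₂.cp n _ hx.2)) using 1
  rw [one_mul, ← hunit, ← ampl_map]
  have h3 : (x.map (antidiagonal 𝒮 𝒯).mkQ).map ((antidiagonal 𝒮 𝒯).liftQ _ hker) =
      ((1 / 2 : ℝ) : ℂ) • ((x.map Prod.fst).map ψ₁ + (x.map Prod.snd).map ψ₂) := by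
    ext i j
    simp
  rw [← h3, hxy]
  ext i j
  simp

theorem isBimoduleMap_liftQ_half_coprod (h𝒮 : 𝒮.IsFaithful) (h𝒯 : 𝒯.IsFaithful)
    (h₁ : IsBimoduleMap 𝒮 ℛ ψ₁) (h₂ : IsBimoduleMap 𝒯 ℛ ψ₂)
    (hker : antidiagonal 𝒮 𝒯 ≤ LinearMap.ker ((1 / 2 : ℂ) • ψ₁.coprod ψ₂)) :
    IsBimoduleMap (OperatorASystem.amalgam h𝒮 h𝒯) ℛ ((antidiagonal 𝒮 𝒯).liftQ _ hker) := by
  intro b c y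
  obtain ⟨x, rfl⟩ := (antidiagonal 𝒮 𝒯).mkQ_surjective y
  rw [← isBimoduleMap_mkQ_amalgam h𝒮 h𝒯 b c x]
  simp [OperatorASystem.prod, h₁ b c, h₂ b c]

end lift

theorem isCoproduct_amalgam (h𝒮 : 𝒮.IsFaithful) (h𝒯 : 𝒯.IsFaithful) :
    IsCoproduct.{u, v, w, max u v, a} 𝒮 𝒯 (OperatorASystem.amalgam h𝒮 h𝒯)
      ((2 : ℂ) • (antidiagonal 𝒮 𝒯).mkQ ∘ₗ LinearMap.inl ℂ S T)
      ((2 : ℂ) • (antidiagonal 𝒮 𝒯).mkQ ∘ₗ LinearMap.inr ℂ S T) where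
  faithful := h𝒮.amalgam h𝒯
  unital₁ := two_smul_mkQ_inl_unit
  unital₂ := two_smul_mkQ_inr_unit
  coe₁ := isCOE_two_smul_mkQ_inl h𝒮 h𝒯
  coe₂ := isCOE_two_smul_mkQ_inr h𝒮 h𝒯
  bimodule₁ := ((isBimoduleMap_mkQ_amalgam h𝒮 h𝒯).comp isBimoduleMap_inl).smul 2
  bimodule₂ := ((isBimoduleMap_mkQ_amalgam h𝒮 h𝒯).comp isBimoduleMap_inr).smul 2
  universal R _ _ ℛ ψ₁ ψ₂ hψ₁ hψ₁' hψ₂ hψ₂' := by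
    have hker := antidiagonal_le_ker_half_coprod hψ₁ hψ₁' hψ₂ hψ₂'
    refine ⟨(antidiagonal 𝒮 𝒯).liftQ _ hker,
      ⟨⟨isUCP_liftQ_half_coprod h𝒮 h𝒯 hψ₁ hψ₂ hker,
        isBimoduleMap_liftQ_half_coprod h𝒮 h𝒯 hψ₁' hψ₂' hker⟩, ?_, ?_⟩, ?_⟩
    · ext s
      simp
    · ext t
      simp
    · rintro Ψ ⟨-, h₁, h₂⟩
      -- The images of the two inclusions span the quotient, so `Ψ` is determined by its values on
      -- them.
      apply Submodule.linearMap_qext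
      ext x
      · have := LinearMap.congr_fun h₁ x
        simp only [LinearMap.comp_apply, LinearMap.smul_apply, map_smul] at this
        simp [← this]
      · have := LinearMap.congr_fun h₂ x
        simp only [LinearMap.comp_apply, LinearMap.smul_apply, map_smul] at this
        simp [← this]

end coproduct
theorem theorem3p4 {A : Type a} [CStarAlgebra A]
    {S : Type u} [AddCommGroup S] [Module ℂ S] {T : Type v} [AddCommGroup T] [Module ℂ T]
    (𝒮 : OperatorASystem A S) (𝒯 : OperatorASystem A T)
    (h𝒮 : 𝒮.IsFaithful) (h𝒯 : 𝒯.IsFaithful) :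
    ∃ hJ : IsKernel (𝒮.prod 𝒯).toOperatorSystem (antidiagonal 𝒮 𝒯),
    ∃ 𝒬 : OperatorASystem A ((S × T) ⧸ antidiagonal 𝒮 𝒯),
      𝒬.toOperatorSystem = (𝒮.prod 𝒯).toOperatorSystem.quotient (antidiagonal 𝒮 𝒯) hJ ∧
      IsUCP (𝒮.prod 𝒯).toOperatorSystem 𝒬.toOperatorSystem (antidiagonal 𝒮 𝒯).mkQ ∧
      IsBimoduleMap (𝒮.prod 𝒯) 𝒬 (antidiagonal 𝒮 𝒯).mkQ ∧
      IsCoproduct.{u, v, w, max u v, a} 𝒮 𝒯 𝒬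
        ((2 : ℂ) • (antidiagonal 𝒮 𝒯).mkQ ∘ₗ LinearMap.inl ℂ S T)
        ((2 : ℂ) • (antidiagonal 𝒮 𝒯).mkQ ∘ₗ LinearMap.inr ℂ S T) ∧
      ∀ (P : Type p) [AddCommGroup P] [Module ℂ P] (𝒢 : OperatorASystem A P)
        (φ₁ : S →ₗ[ℂ] P) (φ₂ : T →ₗ[ℂ] P),
        IsCoproduct.{u, v, max u v p, p, a} 𝒮 𝒯 𝒢 φ₁ φ₂ →
        ∃ Θ : ((S × T) ⧸ antidiagonal 𝒮 𝒯) ≃ₗ[ℂ] P,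
          Θ (𝒬.unit) = 𝒢.unit ∧
          IsCOI 𝒬.toOperatorSystem 𝒢.toOperatorSystem Θ ∧
          IsBimoduleMap 𝒬 𝒢 Θ ∧
          (∀ s : S, Θ ((2 : ℂ) • (antidiagonal 𝒮 𝒯).mkQ (s, 0)) = φ₁ s) ∧
          ∀ t : T, Θ ((2 : ℂ) • (antidiagonal 𝒮 𝒯).mkQ (0, t)) = φ₂ t := by
  refine ⟨isKernel_antidiagonal h𝒮 h𝒯, OperatorASystem.amalgam h𝒮 h𝒯, rfl,
    isUCP_mkQ_amalgam h𝒮 h𝒯, isBimoduleMap_mkQ_amalgam h𝒮 h𝒯, isCoproduct_amalgam h𝒮 h𝒯, ?_⟩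
  intro P _ _ 𝒢 φ₁ φ₂ h𝒢
  -- The universal property of `P` is assumed for test objects in `max u v p`, which covers both the
  -- universe of the quotient and that of `P`.
  exact IsCoproduct.exists_equiv (isCoproduct_amalgam h𝒮 h𝒯) (isCoproduct_amalgam h𝒮 h𝒯)
    (IsCoproduct.of_max.{u, v, max u v, p, a, p} h𝒢)
    (IsCoproduct.of_max.{u, v, p, p, a, max u v} h𝒢)
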